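/- **Conventions.** Let $A$ be a commutative ring with unit and $G\neq 0$ an $A$-module. A simplicial complex is a (possibly empty) set $\Sigma$ of finite sets closed under taking subsets; $\emptyset$ is allowed as a simplex, of dimension $-1$ (generally $\dim\sigma=\#\sigma-1$), so $\emptyset$ and $\{\emptyset\}$ are different complexes. $H_i(\Sigma,\Delta;G)$ ($i\in\mathbb Z$) denotes the homology of the pair of *augmented* simplicial chain complexes (the simplex $\emptyset$ spans degree $-1$): it is reduced homology if $\Delta=\emptyset$, ordinary relative homology if $\Delta\ne\emptyset$. Put $\mathrm{cost}_\Sigma\sigma=\{\tau\in\Sigma: \sigma\not\subseteq\tau\}$; $H_i(\Sigma,\mathrm{cost}_\Sigma\sigma;G)$ is the local homology of $\Sigma$ at the interior points of $\sigma$ (and the reduced homology of $\Sigma$ for $\sigma=\emptyset$). Let $n=\dim\Sigma$. * $\Sigma$ is a *homology$_G$ $n$-manifold* if it consists of exactly two vertices (and $\emptyset$), or it is connected, locally finite, and for all $\emptyset\ne\sigma\in\Sigma$ one has $H_i(\Sigma,\mathrm{cost}_\Sigma\sigma;G)=0$ for $i\ne n$ and $H_n(\Sigma,\mathrm{cost}_\Sigma\sigma;G)\cong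 0$ or $G$, with $\cong G$ for some $\sigma\in\Sigma$ ($\sigma = \emptyset$ allowed here). * $\mathrm{Bd}_G\Sigma=\{\sigma\in\Sigma: H_n(\Sigma,\mathrm{cost}_\Sigma\sigma;G)=0\}$; the manifold is *with boundary* if $\mathrm{Bd}_G\Sigma\neq\emptyset$, *without boundary* if $\mathrm{Bd}_G\Sigma=\emptyset$. A finite homology$_G$ $n$-manifold is *orientable$_G$* if $H_n(\Sigma,\mathrm{Bd}_G\Sigma;G)\cong G$. * $\Sigma$ is *CM$_G$* if $H_i(\Sigma,\mathrm{cost}_\Sigma\sigma;G)=0$ for all $\sigma\in\Sigma$ (including $\sigma=\emptyset$) and all $i\neq n$. * A finite complex $\Sigma\neq\emptyset$ is *Gorenstein$_G$* if its core $\Gamma$ (the simplices containing no vertex that lies in all maximal simplices of $\Sigma$) satisfies, for all $\sigma\in\Gamma$ (including $\emptyset$), $H_i(\Gamma,\mathrm{cost}_\Gamma\sigma;G)=0$ for $i\neq\dim\Gamma$ and $\cong G$ for $i=\dim\Gamma$. **Theorem 13.** Let $\Sigma$ be a finite orientable$_G$ CM$_G$ homology$_G$ $n$-manifold with boundary. If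 $G\cong G^m$ for some $m\ge 2$, assume in addition that every $(n-1)$-simplex of $\Sigma$ lies in at most two $n$-simplices. Then $\mathrm{Bd}_G\Sigma$ is a simplicial complex and is an orientable$_G$ homology$_G$ $(n-1)$-manifold without boundary. Moreover, $\mathrm{Bd}_G\Sigma$ is Gorenstein$_G$. -/

import Mathlib

open scoped Finset

noncomputable section

namespace Augmental

/-! An abstract simplicial complex on vertices from `V` is a set `K : Set (Finset V)` with
`IsLowerSet K`.  The empty simplex is allowed, so that the complexes `∅` and `{∅}` are different;
the vertices of `K` are the `v` with `{v} ∈ K`, and a simplex `σ` has dimension `#σ - 1`. -/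

variable (A G : Type*) {V : Type*} [CommRing A] [AddCommGroup G] [Module A G] [LinearOrder V]

/-- `K` has dimension `n`; the complex `{∅}` has dimension `-1`, the complex `∅` has none. -/
def HasDim (K : Set (Finset V)) (n : ℤ) : Prop :=
  IsGreatest ((fun σ : Finset V => (#σ : ℤ) - 1) '' K) n

/-- The contrastar of `σ` in `K`: the simplices of `K` that do not contain `σ`. -/
def cost (K : Set (Finset V)) (σ : Finset V) : Set (Finset V) :=
  {τ | τ ∈ K ∧ ¬ σ ⊆ τ}

/-- The `i`-chains of `K` with coefficients in `G` (augmented: the empty simplex spans the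
chains of degree `-1`). -/
def chains (K : Set (Finset V)) (i : ℤ) : Submodule A (Finset V →₀ G) :=
  Finsupp.supported G A {σ | σ ∈ K ∧ (#σ : ℤ) = i + 1}

/-- The simplicial boundary operator, simplices being oriented by the order of `V`:
`g • {v₀ < ⋯ < v_q}` goes to the sum of the `(-1)^j g • {v₀, …, v_q} \ {v_j}`.
In particular `∂ (g • {v}) = g • ∅` and `∂ (g • ∅) = 0`. -/
def bdry : (Finset V →₀ G) →ₗ[A] (Finset V →₀ G) :=
  Finsupp.lsum A fun σ : Finset V =>
    ∑ v ∈ σ, ((-1 : ℤ) ^ #{w ∈ σ | w < v}) • (Finsupp.lsingle (σ.erase v) : G →ₗ[A] _)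

/-- Relative cycles: the `i`-chains of `K` whose boundary lies in `L`. -/
def relCycles (K L : Set (Finset V)) (i : ℤ) : Submodule A (Finset V →₀ G) :=
  chains A G K i ⊓ (chains A G L (i - 1)).comap (bdry A G)

/-- Relative boundaries: the boundaries of `(i+1)`-chains of `K`, up to `i`-chains of `L`. -/
def relBoundaries (K L : Set (Finset V)) (i : ℤ) : Submodule A (Finset V →₀ G) :=
  (chains A G K (i + 1)).map (bdry A G) ⊔ chains A G L i

/-- The relative (augmented) simplicial homology module `H_i(K, L; G)` of a complex `K` and a
subcomplex `L`.  For `L = ∅` this is reduced homology, for `L ≠ ∅` ordinary relative homology. -/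
abbrev Homology (K L : Set (Finset V)) (i : ℤ) : Type _ :=
  relCycles A G K L i ⧸ (relBoundaries A G K L i).submoduleOf (relCycles A G K L i)

/-- The local homology of `K` at (any point of the open simplex of) `σ`, in degree `i`.
At `σ = ∅` it is the reduced homology of `K`. -/
abbrev LocalHomology (K : Set (Finset V)) (σ : Finset V) (i : ℤ) : Type _ :=
  Homology A G K (cost K σ) i

/-- The vertices of `K` are connected to each other by paths of edges. -/
def IsConnected (K : Set (Finset V)) : Prop :=
  ∀ u v : V, {u} ∈ K → {v} ∈ K → Relation.ReflTransGen (fun x y : V => {x, y} ∈ K) u v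

/-- Every vertex lies in finitely many simplices. -/
def IsLocallyFinite (K : Set (Finset V)) : Prop :=
  ∀ v : V, {σ | σ ∈ K ∧ v ∈ σ}.Finite

/-- `K` is the 0-dimensional complex with exactly two vertices. -/
def IsTwoPoints (K : Set (Finset V)) : Prop :=
  ∃ a b : V, a ≠ b ∧ K = {∅, {a}, {b}}

/-- The complex `K` is a homology `n`-manifold with respect to `G`. -/
def IsHomologyManifold (K : Set (Finset V)) (n : ℤ) : Prop :=
  (IsTwoPoints K ∧ n = 0) ∨
  (HasDim K n ∧ IsConnected K ∧ IsLocallyFinite K ∧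
    (∀ σ ∈ K, σ ≠ ∅ → ∀ i : ℤ, i ≠ n → Subsingleton (LocalHomology A G K σ i)) ∧
    (∀ σ ∈ K, σ ≠ ∅ → Subsingleton (LocalHomology A G K σ n) ∨
      Nonempty (LocalHomology A G K σ n ≃ₗ[A] G)) ∧
    (∃ σ ∈ K, Nonempty (LocalHomology A G K σ n ≃ₗ[A] G)))

/-- The boundary with respect to `G` of an `n`-manifold `K`. -/
def Bd (K : Set (Finset V)) (n : ℤ) : Set (Finset V) :=
  {σ | σ ∈ K ∧ Subsingleton (LocalHomology A G K σ n)}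

/-- Orientability with respect to `G` of a finite `n`-manifold `K`. -/
def IsOrientable (K : Set (Finset V)) (n : ℤ) : Prop :=
  Nonempty (Homology A G K (Bd A G K n) n ≃ₗ[A] G)

/-- The `n`-dimensional complex `K` is Cohen–Macaulay with respect to `G`.  (The empty simplex is
included among the `σ`.) -/
def IsCohenMacaulay (K : Set (Finset V)) (n : ℤ) : Prop :=
  HasDim K n ∧ ∀ σ ∈ K, ∀ i : ℤ, i ≠ n → Subsingleton (LocalHomology A G K σ i)

/-- `v` is a vertex of `K` that lies in every maximal simplex of `K`. -/
def IsConePoint (K : Set (Finset V)) (v : V) : Prop :=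
  {v} ∈ K ∧ ∀ σ, Maximal (· ∈ K) σ → v ∈ σ

/-- The simplices of `K` that contain no cone point. -/
def core (K : Set (Finset V)) : Set (Finset V) :=
  {σ | σ ∈ K ∧ ∀ v ∈ σ, ¬ IsConePoint K v}

/-- The finite complex `K ≠ ∅` is Gorenstein with respect to `G`: its core has, at all its
simplices including the empty one, the local homology of a sphere of the same dimension. -/
def IsGorenstein (K : Set (Finset V)) : Prop :=
  K.Finite ∧ K.Nonempty ∧ ∃ m : ℤ, HasDim (core K) m ∧ ∀ σ ∈ core K,
    (∀ i : ℤ, i ≠ m → Subsingleton (LocalHomology A G (core K) σ i)) ∧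
    Nonempty (LocalHomology A G (core K) σ m ≃ₗ[A] G)

end Augmental

end

/-!
Write `K` for the manifold, `n` for its dimension (facets have `N + 1 = n + 1` vertices, ridges have
`N`) and `B` for its boundary.

*The shape of the boundary.*  Vanishing of the low local homology makes `K` pure and lets one go
between any two facets over a simplex `ρ` through ridges over `ρ`
(`IsFiniteCM.facet_induction`).  A ridge lying in `d` facets has top local homology `G ^ (d - 1)`,
so `d ≤ 2`; hence a top cycle around `ρ` is determined up to signs by one of its values, and it is
zero if some ridge over `ρ` lies in a single facet.  As `H_n(K, B; G) ≅ G`, there is a relative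
cycle that is not killed by `2`, whose signs orient the facets coherently (`e F = ± 1`), unless
`2 G = 0`, and then signs do not matter: one computes over `ZMod 2` in place of `ℤ`.  Therefore
`B` consists of the faces of the ridges that lie in one facet (`IsFiniteCM.bd_eq`), and at all
other simplices the top local cycles are the multiples of the fundamental class `∑ e F • F`.

*Duality.*  For `σ ∈ B` take the double complex spanned by the pairs `ρ ⊆ τ` of simplices over
`σ`, with the coboundary acting on `ρ` and the boundary on `τ`.  Its columns (fixed `ρ`) compute
the local homology at `ρ`, and become exact once the fundamental class is adjoined for
`ρ ∉ B`; its rows (fixed `τ`) are the cochains of an interval `[σ, τ]`, exact unless `τ = σ`.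
Comparing both, the cochains of the interior simplices over `σ`, augmented by evaluation on the
fundamental class, form an exact complex.  Exactness with
coefficients in `G` of a complex of finite free modules over a principal ideal domain passes to
the transposed complex, by the Smith normal form (`IsExact.transpose`); so the relative chains of
`(K, B)` around `σ`, augmented by the fundamental class, are exact too
(`IsFundamental.isExact_interior`).  As all chains of `K` around `σ` form an exact complex, so do the chains of `B` around `σ`, augmented by the boundary of the
fundamental class (`IsFundamental.isExact_boundary`).

This says that `B` has at each of its simplices, the empty one included, the local homology of an
`(n - 1)`-sphere, generated by a class with coefficients `± 1` (`IsFiniteSphere`).  The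
assertions about `B` are formal consequences; in particular a cone point of `B` would make its
top homology vanish, so `B` is its own core.

Complexes are handled as ungraded differential modules given by a matrix on a finite set of
cells (`IsExact`); exactness of a total complex then follows from that of the pieces of a
filtration (`IsExact.of_filtration`), and double complexes need no sign or degree bookkeeping
beyond the verification that the square of the matrix is zero.
-/

open scoped Finset

noncomputable section

namespace Augmental

/-! ### Differential modules given by matrices -/

section Exactness

variable {ι κ R G : Type*} [CommRing R] [AddCommGroup G] [Module R G]

/-- The differential of `x` in the module of functions `X → G`: the row `i` of the matrix `M`
collects the coefficients of the cell `i` in the differentials of the cells `j ∈ X`. Functions are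
defined on all of `ι`; values outside of `X` are ignored. -/
def dif (M : ι → ι → R) (X : Finset ι) (x : ι → G) (i : ι) : G := ∑ j ∈ X, M i j • x j

variable (G) in
/-- The kernel of the differential that `M` induces on the functions `X → G` is contained in its
image. -/
def IsExact (M : ι → ι → R) (X : Finset ι) : Prop :=
  ∀ x : ι → G, (∀ i ∈ X, dif M X x i = 0) → ∃ y : ι → G, ∀ i ∈ X, x i = dif M X y i

/-- The block of `M` on `X` has square zero. -/
def SqZero (M : ι → ι → R) (X : Finset ι) : Prop :=
  ∀ i ∈ X, ∀ j ∈ X, ∑ k ∈ X, M i k * M k j = 0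

variable {M M' : ι → ι → R} {X Y Z : Finset ι}

lemma dif_congr {x y : ι → G} {i : ι} (h : ∀ j ∈ X, M i j ≠ 0 → x j = y j) :
    dif M X x i = dif M X y i := by
  refine Finset.sum_congr rfl fun j hj => ?_
  by_cases hM : M i j = 0
  · simp [hM]
  · rw [h j hj hM]

lemma dif_matrix_congr {x : ι → G} {i : ι} (h : ∀ j ∈ X, M i j = M' i j) :
    dif M X x i = dif M' X x i :=
  Finset.sum_congr rfl fun j hj => by rw [h j hj]

lemma dif_eq_zero {x : ι → G} {i : ι} (h : ∀ j ∈ X, M i j ≠ 0 → x j = 0) :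
    dif M X x i = 0 := by
  rw [dif_congr (y := 0) h]; simp [dif]

lemma dif_sub (x y : ι → G) (i : ι) : dif M X (x - y) i = dif M X x i - dif M X y i := by
  simp [dif, smul_sub]

lemma dif_dif (h : SqZero M X) (x : ι → G) {i : ι} (hi : i ∈ X) :
    dif M X (dif M X x) i = 0 := by
  simp only [dif, Finset.smul_sum, smul_smul]
  rw [Finset.sum_comm]
  refine Finset.sum_eq_zero fun j hj => ?_
  rw [← Finset.sum_smul, h i hi j hj, zero_smul]

lemma SqZero.mono (h : SqZero M X) (hYX : Y ⊆ X)
    (hc : ∀ i ∈ Y, ∀ j ∈ Y, ∀ k ∈ X, M i k ≠ 0 → M k j ≠ 0 → k ∈ Y) : SqZero M Y := by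
  intro i hi j hj
  rw [← h i (hYX hi) j (hYX hj)]
  refine Finset.sum_subset hYX fun k hk hkY => ?_
  by_contra hne
  exact hkY (hc i hi j hj k hk (left_ne_zero_of_mul hne) (right_ne_zero_of_mul hne))

lemma IsExact.congr (h : IsExact G M X) (hM : ∀ i ∈ X, ∀ j ∈ X, M i j = M' i j) :
    IsExact G M' X := by
  intro x hx
  obtain ⟨y, hy⟩ := h x fun i hi => by rw [dif_matrix_congr (hM i hi), hx i hi]
  exact ⟨y, fun i hi => by rw [hy i hi, dif_matrix_congr (hM i hi)]⟩

lemma isExact_empty : IsExact G M (∅ : Finset ι) := fun _ _ => ⟨0, by simp⟩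

lemma IsExact.map {M : κ → κ → R} (φ : ι ↪ κ)
    (h : IsExact G (fun i j => M (φ i) (φ j)) X) : IsExact G M (X.map φ) := by
  intro x hx
  obtain ⟨y, hy⟩ := h (fun i => x (φ i)) fun i hi => by
    simpa [dif] using hx (φ i) (Finset.mem_map_of_mem _ hi)
  refine ⟨Function.extend φ y 0, fun _ hi' => ?_⟩
  obtain ⟨i, hi, rfl⟩ := Finset.mem_map.1 hi'
  simpa [dif, φ.injective.extend_apply] using hy i hi

lemma IsExact.comap {M : κ → κ → R} (φ : ι ↪ κ) (h : IsExact G M (X.map φ)) :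
    IsExact G (fun i j => M (φ i) (φ j)) X := by
  intro x hx
  obtain ⟨y, hy⟩ := h (Function.extend φ x 0) fun _ hi' => by
    obtain ⟨i, hi, rfl⟩ := Finset.mem_map.1 hi'
    simpa [dif, φ.injective.extend_apply] using hx i hi
  refine ⟨fun i => y (φ i), fun i hi => ?_⟩
  simpa [dif, φ.injective.extend_apply] using hy (φ i) (Finset.mem_map_of_mem _ hi)

/-- Signs `w` that alternate along the nonzero entries of the matrix do not influence exactness. -/
lemma IsExact.untwist {w : ι → R} (hw : ∀ i ∈ X, w i * w i = 1)
    (hwM : ∀ i ∈ X, ∀ j ∈ X, M i j ≠ 0 → w i = - w j)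
    (h : IsExact G (fun i j => w j * M i j) X) : IsExact G M X := by
  intro x hx
  obtain ⟨y, hy⟩ := h (fun i => w i • x i) fun i hi => by
    rw [← hx i hi]
    refine Finset.sum_congr rfl fun j hj => ?_
    rw [smul_smul, mul_right_comm, hw j hj, one_mul]
  refine ⟨-y, fun i hi => ?_⟩
  have := congrArg (w i • ·) (hy i hi)
  simp only [smul_smul, hw i hi, one_smul] at this
  rw [this, dif, dif, Finset.smul_sum]
  refine Finset.sum_congr rfl fun j hj => ?_
  by_cases hM : M i j = 0
  · simp [hM]
  · rw [hwM i hi j hj hM, Pi.neg_apply, smul_neg, smul_smul, neg_mul, ← mul_assoc, hw j hj,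
      one_mul, neg_smul]

lemma isExact_pair [DecidableEq ι] {a b : ι} (hab : a ≠ b) (haa : M a a = 0) (hbb : M b b = 0)
    (h' : M b a = 0) (h : IsUnit (M a b)) : IsExact G M {a, b} := by
  intro x hx
  obtain ⟨u, hu⟩ := h
  have ha := hx a (by simp)
  simp only [dif, Finset.sum_pair hab, haa, zero_smul, zero_add, ← hu] at ha
  have hb : x b = 0 := by
    have := congrArg ((↑u⁻¹ : R) • ·) ha
    simpa [smul_smul] using this
  refine ⟨fun _ => (↑u⁻¹ : R) • x a, fun i hi => ?_⟩
  rcases Finset.mem_insert.1 hi with rfl | hi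
  · simp [dif, Finset.sum_pair hab, haa, ← hu, smul_smul]
  · rw [Finset.mem_singleton.1 hi]
    simp [dif, Finset.sum_pair hab, hbb, h', hb]

section TwoStep

variable [DecidableEq ι]

lemma dif_union_piecewise (hYZ : Disjoint Y Z) (y z : ι → G) (i : ι) :
    dif M (Y ∪ Z) (Z.piecewise z y) i = dif M Y y i + dif M Z z i := by
  rw [dif, Finset.sum_union hYZ]
  congr 1
  · exact Finset.sum_congr rfl fun j hj => by
      rw [Finset.piecewise_eq_of_notMem _ _ _ (Finset.disjoint_left.1 hYZ hj)]
  · exact Finset.sum_congr rfl fun j hj => by rw [Finset.piecewise_eq_of_mem _ _ _ hj]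

lemma dif_union (hYZ : Disjoint Y Z) (x : ι → G) (i : ι) :
    dif M (Y ∪ Z) x i = dif M Y x i + dif M Z x i := Finset.sum_union hYZ

omit [DecidableEq ι] in
lemma dif_zero (i : ι) : dif M X (0 : ι → G) i = 0 := by simp [dif]

variable (hYZ : Disjoint Y Z) (hc : ∀ i ∈ Z, ∀ j ∈ Y, M i j = 0) (hsq : SqZero M (Y ∪ Z))
include hYZ hc hsq

/-- If the cells `Y` span a submodule, `Z` the quotient by it, and both are exact, so is the whole.
-/
lemma IsExact.union (hY : IsExact G M Y) (hZ : IsExact G M Z) : IsExact G M (Y ∪ Z) := by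
  intro x hx
  have hc0 : ∀ i ∈ Z, ∀ x : ι → G, dif M Y x i = 0 := fun i hi x =>
    dif_eq_zero fun j hj hne => absurd (hc i hi j hj) hne
  obtain ⟨z, hz⟩ := hZ x fun i hi => by
    have := hx i (Finset.mem_union_right _ hi)
    rwa [dif_union hYZ, hc0 i hi, zero_add] at this
  set z' : ι → G := Z.piecewise z 0
  have hz' : ∀ i, dif M (Y ∪ Z) z' i = dif M Z z i := fun i => by
    rw [dif_union_piecewise hYZ, dif_zero, zero_add]
  obtain ⟨y, hy⟩ := hY (x - dif M (Y ∪ Z) z') fun i hi => by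
    have hi' := Finset.mem_union_left Z hi
    have h1 : dif M (Y ∪ Z) (x - dif M (Y ∪ Z) z') i = 0 := by
      rw [dif_sub, hx i hi', dif_dif hsq _ hi', sub_zero]
    rw [dif_union hYZ, dif_eq_zero (X := Z), add_zero] at h1
    · exact h1
    · intro j hj _
      rw [Pi.sub_apply, hz', hz j hj, sub_self]
  refine ⟨Z.piecewise z y, fun i hi => ?_⟩
  rw [dif_union_piecewise hYZ]
  rcases Finset.mem_union.1 hi with hi | hi
  · rw [← hy i hi, Pi.sub_apply, hz', sub_add_cancel]
  · rw [hc0 i hi, zero_add, hz i hi]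

lemma IsExact.quotient (hX : IsExact G M (Y ∪ Z)) (hY : IsExact G M Y) : IsExact G M Z := by
  intro z hz
  have hc0 : ∀ i ∈ Z, ∀ x : ι → G, dif M Y x i = 0 := fun i hi x =>
    dif_eq_zero fun j hj hne => absurd (hc i hi j hj) hne
  set z' : ι → G := Z.piecewise z 0
  have hz' : ∀ i, dif M (Y ∪ Z) z' i = dif M Z z i := fun i => by
    rw [dif_union_piecewise hYZ, dif_zero, zero_add]
  obtain ⟨y, hy⟩ := hY (dif M (Y ∪ Z) z') fun i hi => by
    have h1 := dif_dif hsq z' (Finset.mem_union_left Z hi)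
    rwa [dif_union hYZ, dif_eq_zero (X := Z), add_zero] at h1
    intro j hj _
    rw [hz', hz j hj]
  obtain ⟨u, hu⟩ := hX (Z.piecewise z (-y)) fun i hi => by
    have hneg : dif M Y (-y) i = - dif M Y y i := by
      rw [← zero_sub y, dif_sub, dif_zero, zero_sub]
    rw [dif_union_piecewise hYZ, hneg]
    rcases Finset.mem_union.1 hi with hi | hi
    · rw [← hy i hi, hz', neg_add_cancel]
    · rw [hc0 i hi, hz i hi, neg_zero, add_zero]
  refine ⟨u, fun i hi => ?_⟩
  have := hu i (Finset.mem_union_right _ hi)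
  rwa [Finset.piecewise_eq_of_mem _ _ _ hi, dif_union hYZ, hc0 i hi, zero_add] at this

lemma IsExact.sub (hX : IsExact G M (Y ∪ Z)) (hZ : IsExact G M Z) : IsExact G M Y := by
  intro y hy
  have hc0 : ∀ i ∈ Z, ∀ x : ι → G, dif M Y x i = 0 := fun i hi x =>
    dif_eq_zero fun j hj hne => absurd (hc i hi j hj) hne
  obtain ⟨u, hu⟩ := hX (Z.piecewise 0 y) fun i hi => by
    rw [dif_union_piecewise hYZ, dif_zero, add_zero]
    rcases Finset.mem_union.1 hi with hi | hi
    · exact hy i hi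
    · exact hc0 i hi y
  obtain ⟨v, hv⟩ := hZ u fun i hi => by
    have := hu i (Finset.mem_union_right _ hi)
    rw [Finset.piecewise_eq_of_mem _ _ _ hi, dif_union hYZ, hc0 i hi, zero_add] at this
    exact this.symm
  set v' : ι → G := Z.piecewise v 0
  have hv' : ∀ i, dif M (Y ∪ Z) v' i = dif M Z v i := fun i => by
    rw [dif_union_piecewise hYZ, dif_zero, zero_add]
  refine ⟨u - dif M (Y ∪ Z) v', fun i hi => ?_⟩
  have hi' := Finset.mem_union_left Z hi
  have h1 : dif M (Y ∪ Z) (u - dif M (Y ∪ Z) v') i = y i := by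
    rw [dif_sub, dif_dif hsq _ hi', sub_zero, ← hu i hi',
      Finset.piecewise_eq_of_notMem _ _ _ (Finset.disjoint_left.1 hYZ hi)]
  rw [dif_union hYZ, dif_eq_zero (X := Z), add_zero] at h1
  · exact h1.symm
  · intro j hj _
    rw [Pi.sub_apply, hv', hv j hj, sub_self]

end TwoStep

/-- A differential that is monotone for an order on the cells is exact if the graded pieces are. -/
lemma IsExact.of_filtration [DecidableEq ι] {α : Type*} [PartialOrder α] [DecidableEq α]
    (f : ι → α)
    (hsq : SqZero M X) (hf : ∀ i ∈ X, ∀ j ∈ X, M i j ≠ 0 → f i ≤ f j)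
    (h : ∀ a, IsExact G M {i ∈ X | f i = a}) : IsExact G M X := by
  induction hn : #X using Nat.strong_induction_on generalizing X with
  | _ n ih =>
  rcases X.eq_empty_or_nonempty with rfl | hne
  · exact isExact_empty
  -- the cells of maximal index form a quotient
  obtain ⟨a, ha⟩ := (X.image f).exists_maximal (hne.image f)
  have hle : ∀ i ∈ X, a ≤ f i → f i = a := fun i hi hai =>
    (ha.eq_of_le (Finset.mem_image_of_mem f hi) hai).symm
  obtain ⟨i₀, hi₀, hi₀a⟩ := Finset.mem_image.1 ha.prop
  have hX : {i ∈ X | f i ≠ a} ∪ {i ∈ X | f i = a} = X := by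
    rw [Finset.union_comm]; exact Finset.filter_union_filter_not_eq _ _
  have hdisj : Disjoint {i ∈ X | f i ≠ a} {i ∈ X | f i = a} :=
    (Finset.disjoint_filter_filter_not X X (fun i => f i = a)).symm
  have hc : ∀ i ∈ ({i ∈ X | f i = a} : Finset ι), ∀ j ∈ ({i ∈ X | f i ≠ a} : Finset ι),
      M i j = 0 := by
    intro i hi j hj
    rw [Finset.mem_filter] at hi hj
    by_contra hM
    exact hj.2 (hle j hj.1 (hi.2 ▸ hf i hi.1 j hj.1 hM))
  have hsub : ({i ∈ X | f i ≠ a} : Finset ι) ⊆ X := Finset.filter_subset _ _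
  rw [← hX]
  refine IsExact.union hdisj hc (by rwa [hX]) ?_ (h a)
  refine ih _ ?_ ?_ (fun i hi j hj => hf i (hsub hi) j (hsub hj)) ?_ rfl
  · rw [← hn]
    refine Finset.card_lt_card ⟨hsub, fun hss => ?_⟩
    exact (Finset.mem_filter.1 (hss hi₀)).2 hi₀a
  · refine hsq.mono hsub fun i hi j hj k hk _ hkj => ?_
    rw [Finset.mem_filter]
    refine ⟨hk, fun hka => hkj (hc k (Finset.mem_filter.2 ⟨hk, hka⟩) j hj)⟩
  · intro b
    by_cases hb : b = a
    · subst hb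
      have : ({i ∈ ({i ∈ X | f i ≠ b} : Finset ι) | f i = b} : Finset ι) = ∅ := by
        ext i; simp +contextual
      rw [this]; exact isExact_empty
    · have : ({i ∈ ({i ∈ X | f i ≠ a} : Finset ι) | f i = b} : Finset ι) =
          ({i ∈ X | f i = b} : Finset ι) := by
        ext i; simp only [Finset.mem_filter]; grind
      rw [this]; exact h b

end Exactness

/-! ### Exactness of the transposed matrix -/

section Transfer

open Module

variable {R G : Type*} [CommRing R] [IsDomain R] [IsPrincipalIdealRing R] [AddCommGroup G]
  [Module R G]

/-- If a square-zero matrix `M` over a principal ideal domain is exact with coefficients in `G`,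
then multiplication by some `s` that is invertible on `G` is null-homotopic over the ground ring.

In bases adapted to the Smith normal form of `im M ⊆ ker M`, the matrix `M` maps vectors `u j` to `a
j • b j`, the `b j` being part of a basis of the kernel. Exactness forces them to be all of that
basis and each `a j` to be invertible on `G`; one takes for `s` the product of the `a j`. -/
lemma exists_homotopy_of_exact [Nontrivial G] {n : Type*} [Fintype n] [DecidableEq n]
    (M : Matrix n n R)
    (hsq : M * M = 0)
    (hM : ∀ x : n → G, (∀ i, ∑ j, M i j • x j = 0) → ∃ y : n → G, ∀ i, x i = ∑ j, M i j • y j) :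
    ∃ (s : R) (H : Matrix n n R), (Function.Bijective fun g : G => s • g) ∧
      M * H + H * M = s • (1 : Matrix n n R) := by
  set E := n → R
  set f : E →ₗ[R] E := M.toLin' with hf
  have hff : ∀ v, f (f v) = 0 := fun v => by
    rw [hf, ← LinearMap.comp_apply, ← Matrix.toLin'_mul, hsq]; simp
  obtain ⟨k, S⟩ := Submodule.smithNormalForm (Free.chooseBasis R (LinearMap.ker f))
    ((LinearMap.range f).comap (LinearMap.ker f).subtype)
  set b := S.bM
  have hu : ∀ j, ∃ u, f u = S.a j • (b (S.f j) : E) := fun j => by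
    obtain ⟨u, hu⟩ := (S.bN j).2
    refine ⟨u, hu.trans ?_⟩
    rw [Submodule.subtype_apply, S.snf j]; rfl
  choose u hu using hu
  set f' : E →ₗ[R] (LinearMap.range f).comap (LinearMap.ker f).subtype :=
    (f.codRestrict (LinearMap.ker f) hff).codRestrict _ (fun v => ⟨v, rfl⟩)
  -- `γ` and `β` are the coordinates with respect to `u` and `b`; the `u j` span a complement of
  -- the kernel, on which `f` is injective
  set γ : Fin k → E →ₗ[R] R := fun j => S.bN.coord j ∘ₗ f'
  have hf' : ∀ v, f v = ∑ j, γ j v • S.a j • (b (S.f j) : E) := fun v => by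
    have h1 : ((f' v : LinearMap.ker f) : E) = f v := rfl
    rw [← h1, ← S.bN.sum_repr (f' v)]
    simp only [Submodule.coe_sum, Submodule.coe_smul, S.snf]
    refine Finset.sum_congr rfl fun j _ => ?_
    simp [γ]; rfl
  have hγu : ∀ j l, γ j (u l) = if l = j then 1 else 0 := fun j l => by
    have : f' (u l) = S.bN l := by
      apply Subtype.ext; apply Subtype.ext
      rw [S.snf l]; exact hu l
    simp only [γ, LinearMap.comp_apply, this, Basis.coord_apply, Basis.repr_self,
      Finsupp.single_apply]
  have hγ : ∀ j v, f v = 0 → γ j v = 0 := fun j v hv => by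
    have : f' v = 0 := by apply Subtype.ext; apply Subtype.ext; exact hv
    simp [γ, this]
  set p₀ : E →ₗ[R] E := LinearMap.id - ∑ j, (γ j).smulRight (u j)
  have hp₀ : ∀ v, p₀ v = v - ∑ j, γ j v • u j := fun v => by simp [p₀]
  set p : E →ₗ[R] LinearMap.ker f := p₀.codRestrict _ fun v => by
    rw [LinearMap.mem_ker, hp₀, map_sub, map_sum, hf' v, sub_eq_zero]
    simp [hu]
  have hp : ∀ v, (p v : E) = v - ∑ j, γ j v • u j := hp₀
  set β : Free.ChooseBasisIndex R (LinearMap.ker f) → E →ₗ[R] R := fun i => b.coord i ∘ₗ p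
  have hpker : ∀ v : LinearMap.ker f, p v = v := fun v => by
    apply Subtype.ext
    rw [hp]
    simp [hγ _ v v.2]
  have hβb : ∀ i l, β i (b l) = if l = i then 1 else 0 := fun i l => by
    simp only [β, LinearMap.comp_apply, hpker, Basis.coord_apply, Basis.repr_self,
      Finsupp.single_apply]
  -- a functional `φ` acts on vectors with entries in `G` by `x ↦ ∑ i, φ (Pi.single i 1) • x i`
  have key : ∀ (φ : E →ₗ[R] R) (y : n → G),
      ∑ i, φ (Pi.single i 1) • ∑ j, M i j • y j = ∑ j, φ (f (Pi.single j 1)) • y j := by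
    intro φ y
    simp only [Finset.smul_sum, smul_smul]
    rw [Finset.sum_comm]
    refine Finset.sum_congr rfl fun j _ => ?_
    rw [← Finset.sum_smul]
    congr 1
    have : f (Pi.single j 1) = ∑ i, M i j • (Pi.single i 1 : n → R) := by
      ext l
      rw [hf, Matrix.toLin'_apply, Matrix.mulVec_single_one]
      simp [Pi.single_apply]
    rw [this, map_sum]
    simp [mul_comm]
  have key2 : ∀ (φ : E →ₗ[R] R) (v : E) (g : G), ∑ i, φ (Pi.single i 1) • (v i • g) = φ v • g := by
    intro φ v g
    simp only [smul_smul]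
    rw [← Finset.sum_smul]
    congr 1
    conv_rhs => rw [pi_eq_sum_univ' v, map_sum]
    refine Finset.sum_congr rfl fun i _ => ?_
    rw [map_smul, smul_eq_mul, mul_comm]
  have key3 : ∀ (v : E) (g : G) i, ∑ j, M i j • (v j • g) = f v i • g := by
    intro v g i
    simp only [smul_smul]
    rw [← Finset.sum_smul]
    congr 1
  have hrep : ∀ i (g : G), ∃ y : n → G, g = ∑ j, β i (f (Pi.single j 1)) • y j := by
    intro i g
    obtain ⟨y, hy⟩ := hM (fun l => (b i : E) l • g) fun l => by
      have hb : f (b i) = 0 := (b i).2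
      rw [key3, hb, Pi.zero_apply, zero_smul]
    refine ⟨y, ?_⟩
    rw [← key, ← one_smul R g]
    have h1 := key2 (β i) (b i) g
    rw [hβb, if_pos rfl] at h1
    rw [← h1]
    exact Finset.sum_congr rfl fun l _ => by rw [hy l]
  have hβf : ∀ i v, β i (f v) = ∑ j, if S.f j = i then γ j v * S.a j else 0 := by
    intro i v
    rw [hf' v, map_sum]
    refine Finset.sum_congr rfl fun j _ => ?_
    rw [map_smul, map_smul, hβb]
    split_ifs <;> simp
  have hsurj : Function.Surjective S.f := by
    intro i
    by_contra hi
    push Not at hi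
    obtain ⟨g, hg⟩ := exists_ne (0 : G)
    obtain ⟨y, hy⟩ := hrep i g
    refine hg (hy.trans (Finset.sum_eq_zero fun j _ => ?_))
    rw [hβf, Finset.sum_eq_zero, zero_smul]
    intro l _
    rw [if_neg (hi l)]
  have hβfe : ∀ j v, β (S.f j) (f v) = γ j v * S.a j := by
    intro j v
    rw [hβf, Finset.sum_eq_single j]
    · simp
    · intro l _ hl
      rw [if_neg (fun h => hl (S.f.injective h))]
    · simp
  have ha : ∀ j, Function.Bijective fun g : G => S.a j • g := by
    intro j
    constructor
    · refine (injective_iff_map_eq_zero (DistribSMul.toAddMonoidHom G (S.a j))).2 fun g hg => ?_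
      replace hg : S.a j • g = 0 := hg
      obtain ⟨y, hy⟩ := hM (fun l => u j l • g) fun l => by
        rw [key3, hu, Pi.smul_apply, smul_eq_mul, mul_comm, mul_smul, hg, smul_zero]
      have h1 := key2 (γ j) (u j) g
      rw [hγu, if_pos rfl, one_smul] at h1
      rw [← h1]
      simp only [hy]
      rw [key]
      simp [hγ _ _ (hff _)]
    · intro g
      obtain ⟨y, hy⟩ := hrep (S.f j) g
      refine ⟨∑ l, γ j (Pi.single l 1) • y l, ?_⟩
      simp only [hβfe] at hy
      rw [hy]
      simp only [Finset.smul_sum]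
      exact Finset.sum_congr rfl fun l _ => by rw [smul_smul, mul_comm]
  set s' : Fin k → R := fun j => ∏ l ∈ Finset.univ.erase j, S.a l
  have hs' : ∀ j, s' j * S.a j = ∏ l, S.a l := fun j => Finset.prod_erase_mul _ _ (Finset.mem_univ j)
  set s := ∏ l, S.a l
  set h : E →ₗ[R] E := ∑ j, (β (S.f j)).smulRight (s' j • u j)
  have hh : ∀ v, h v = ∑ j, β (S.f j) v • s' j • u j := fun v => by simp [h]
  have hfh : ∀ v, f (h v) = s • (p v : E) := by
    intro v
    have : p v = ∑ i, β i v • b i := (b.sum_repr (p v)).symm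
    rw [hh, map_sum, this]
    simp only [map_smul, hu, Submodule.coe_sum, Submodule.coe_smul, Finset.smul_sum]
    rw [← Function.Bijective.sum_comp ⟨S.f.injective, hsurj⟩]
    refine Finset.sum_congr rfl fun j _ => ?_
    rw [smul_smul (s' j), hs', smul_comm]
  have hhf : ∀ v, h (f v) = s • (v - (p v : E)) := by
    intro v
    rw [hh, hp, sub_sub_cancel, Finset.smul_sum]
    refine Finset.sum_congr rfl fun j _ => ?_
    rw [hβfe, smul_smul, smul_smul, ← hs' j]
    congr 1; ring
  refine ⟨s, LinearMap.toMatrix' h, ?_, ?_⟩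
  · have : ∀ t : Finset (Fin k), Function.Bijective fun g : G => (∏ l ∈ t, S.a l) • g := by
      intro t
      induction t using Finset.induction_on with
      | empty => simp only [Finset.prod_empty, one_smul]; exact Function.bijective_id
      | insert j t hj ih =>
        rw [Finset.prod_insert hj]
        simp only [mul_smul]
        exact (ha j).comp ih
    exact this _
  · have : M = LinearMap.toMatrix' f := by simp [hf]
    rw [this, ← LinearMap.toMatrix'_comp, ← LinearMap.toMatrix'_comp, ← map_add]
    have : f ∘ₗ h + h ∘ₗ f = s • LinearMap.id := by
      refine LinearMap.ext fun v => ?_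
      simp only [LinearMap.add_apply, LinearMap.comp_apply, LinearMap.smul_apply, hfh, hhf]
      simp [← smul_add]
    rw [this, map_smul, LinearMap.toMatrix'_id]

/-- Exactness with coefficients in `G` passes to the transposed matrix, since a null-homotopy of a
scalar can be transposed. -/
lemma IsExact.transpose {ι : Type*} {M : ι → ι → R} {X : Finset ι} (hsq : SqZero M X)
    (h : IsExact G M X) : IsExact G (fun i j => M j i) X := by
  classical
  intro x hx
  rcases subsingleton_or_nontrivial G with hG | hG
  · exact ⟨0, fun _ _ => Subsingleton.elim _ _⟩
  obtain ⟨s, H, hs, hH⟩ := exists_homotopy_of_exact (G := G)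
    (Matrix.of fun i j : X => M i j) (by
      ext i j
      rw [Matrix.mul_apply]
      exact (Finset.sum_coe_sort X fun k => M i k * M k j).trans (hsq i i.2 j j.2)) (by
    intro x hx
    obtain ⟨y, hy⟩ := h (Function.extend Subtype.val x 0) fun i hi => by
      rw [← hx ⟨i, hi⟩, dif, ← Finset.sum_coe_sort]
      exact Finset.sum_congr rfl fun j _ => by rw [Subtype.val_injective.extend_apply]; rfl
    refine ⟨fun i => y i, fun i => ?_⟩
    have := hy i i.2
    rw [Subtype.val_injective.extend_apply] at this
    rw [this, dif, ← Finset.sum_coe_sort]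
    simp)
  have hsurj : ∀ g : G, ∃ g', s • g' = g := hs.2
  choose t ht using hsurj
  have hcyc : ∀ i : X, ∑ j : X, M j i • t (x j) = 0 := by
    intro i
    apply hs.1
    change s • _ = s • (0 : G)
    have h0 := hx i i.2
    rw [dif, ← Finset.sum_coe_sort] at h0
    rw [smul_zero, Finset.smul_sum, ← h0]
    exact Finset.sum_congr rfl fun j _ => by rw [smul_comm, ht]
  refine ⟨Function.extend Subtype.val (fun j : X => ∑ k : X, H k j • t (x k)) 0, fun i hi => ?_⟩
  rw [dif, ← Finset.sum_coe_sort]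
  simp only [Subtype.val_injective.extend_apply, Finset.smul_sum, smul_smul]
  rw [Finset.sum_comm]
  have e1 : ∀ k : X, (∑ j : X, M j i * H k j) =
      (s • (1 : Matrix X X R)) k ⟨i, hi⟩ - ∑ j : X, M k j * H j ⟨i, hi⟩ := by
    intro k
    rw [← hH]
    simp [Matrix.mul_apply, mul_comm]
  simp only [← Finset.sum_smul, e1, sub_smul,
    Finset.sum_sub_distrib]
  have e2 : ∑ k : X, (∑ j : X, M k j * H j ⟨i, hi⟩) • t (x k) = 0 := by
    simp only [Finset.sum_smul]
    rw [Finset.sum_comm]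
    refine Finset.sum_eq_zero fun j _ => ?_
    rw [← smul_zero (H j ⟨i, hi⟩), ← hcyc j, Finset.smul_sum]
    refine Finset.sum_congr rfl fun k _ => ?_
    rw [smul_smul, mul_comm]
  rw [e2, sub_zero, Finset.sum_eq_single ⟨i, hi⟩]
  · simp [ht]
  · intro k _ hk
    simp [hk]
  · simp

end Transfer

/-! ### Incidence numbers of simplices -/

section Incidence

variable {V : Type*} [LinearOrder V] {σ τ ρ π : Finset V}

/-- The incidence number of `τ` and `ρ`: the coefficient of `ρ` in the boundary of `τ`. -/
def inc (τ ρ : Finset V) : ℤ :=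
  ∑ v ∈ τ, if τ.erase v = ρ then (-1) ^ #{w ∈ τ | w < v} else 0

lemma inc_erase {v : V} (hv : v ∈ τ) : inc τ (τ.erase v) = (-1) ^ #{w ∈ τ | w < v} := by
  rw [inc, Finset.sum_eq_single v]
  · simp
  · intro w hw hwv
    rw [if_neg]
    intro h
    exact Finset.notMem_erase w τ (h ▸ Finset.mem_erase.2 ⟨hwv, hw⟩)
  · exact fun h => absurd hv h

lemma exists_erase_of_inc_ne_zero (h : inc τ ρ ≠ 0) : ∃ v ∈ τ, τ.erase v = ρ := by
  obtain ⟨v, hv, hne⟩ := Finset.exists_ne_zero_of_sum_ne_zero h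
  exact ⟨v, hv, by by_contra h'; exact hne (if_neg h')⟩

lemma subset_of_inc_ne_zero (h : inc τ ρ ≠ 0) : ρ ⊆ τ := by
  obtain ⟨v, -, rfl⟩ := exists_erase_of_inc_ne_zero h
  exact Finset.erase_subset _ _

lemma card_of_inc_ne_zero (h : inc τ ρ ≠ 0) : #τ = #ρ + 1 := by
  obtain ⟨v, hv, rfl⟩ := exists_erase_of_inc_ne_zero h
  rw [Finset.card_erase_add_one hv]

lemma inc_self (τ : Finset V) : inc τ τ = 0 := by
  by_contra h
  have := card_of_inc_ne_zero h
  omega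

lemma inc_eq_one_or (h : ρ ⊆ τ) (hc : #τ = #ρ + 1) : inc τ ρ = 1 ∨ inc τ ρ = -1 := by
  obtain ⟨v, hv, rfl⟩ := (Finset.covBy_iff_exists_insert.1
    (Finset.covBy_iff_card_sdiff_eq_one.2 ⟨h, by rw [Finset.card_sdiff_of_subset h]; omega⟩))
  have := inc_erase (Finset.mem_insert_self v ρ)
  rw [Finset.erase_insert hv] at this
  rw [this]
  exact neg_one_pow_eq_or ℤ _

lemma inc_erase_erase {v w : V} (hv : v ∈ τ) (hw : w ∈ τ) (hvw : v < w) :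
    inc τ (τ.erase v) * inc (τ.erase v) ((τ.erase v).erase w) +
      inc τ (τ.erase w) * inc (τ.erase w) ((τ.erase w).erase v) = 0 := by
  rw [inc_erase hv, inc_erase hw, inc_erase (Finset.mem_erase.2 ⟨hvw.ne', hw⟩),
    inc_erase (Finset.mem_erase.2 ⟨hvw.ne, hv⟩)]
  have h1 : ({x ∈ τ.erase w | x < v} : Finset V) = {x ∈ τ | x < v} := by
    ext x; simp only [Finset.mem_filter, Finset.mem_erase]
    constructor
    · tauto
    · rintro ⟨h1, h2⟩; exact ⟨⟨(h2.trans hvw).ne, h1⟩, h2⟩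
  have h2 : ({x ∈ τ.erase v | x < w} : Finset V) = ({x ∈ τ | x < w} : Finset V).erase v := by
    ext x; simp only [Finset.mem_filter, Finset.mem_erase]; tauto
  have h3 : v ∈ ({x ∈ τ | x < w} : Finset V) := Finset.mem_filter.2 ⟨hv, hvw⟩
  rw [h1, h2, ← Finset.card_erase_add_one h3, pow_succ]
  ring

/-- The boundary of the boundary is zero; `X` may be any set of simplices that contains the
simplices between `π` and `τ`. -/
lemma inc_sq {X : Finset (Finset V)} (hX : ∀ ρ, π ⊆ ρ → ρ ⊆ τ → ρ ∈ X) :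
    ∑ ρ ∈ X, inc τ ρ * inc ρ π = 0 := by
  by_cases h : π ⊆ τ ∧ #τ = #π + 2
  · obtain ⟨hs, hc⟩ := h
    obtain ⟨v, w, hvw, h2⟩ : ∃ v w, v ≠ w ∧ τ \ π = {v, w} :=
      Finset.card_eq_two.1 (by rw [Finset.card_sdiff_of_subset hs]; omega)
    wlog hlt : v < w generalizing v w
    · exact this w v hvw.symm (by rw [h2, Finset.pair_comm])
        (lt_of_le_of_ne (not_lt.1 hlt) hvw.symm)
    have hv : v ∈ τ \ π := h2 ▸ by simp
    have hw : w ∈ τ \ π := h2 ▸ by simp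
    rw [Finset.mem_sdiff] at hv hw
    have hπ : π = (τ.erase v).erase w := by
      ext x
      have := Finset.ext_iff.1 h2 x
      simp only [Finset.mem_sdiff, Finset.mem_insert, Finset.mem_singleton] at this
      simp only [Finset.mem_erase]
      have := @hs x
      grind
    have hne : τ.erase v ≠ τ.erase w := fun h =>
      Finset.notMem_erase v τ (h ▸ Finset.mem_erase.2 ⟨hvw, hv.1⟩)
    have hπ' : π = (τ.erase w).erase v := by rw [hπ, Finset.erase_right_comm]
    rw [← inc_erase_erase hv.1 hw.1 hlt]
    rw [← hπ, ← hπ', ← Finset.sum_pair hne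
      (f := fun ρ => inc τ ρ * inc ρ π)]
    refine (Finset.sum_subset ?_ ?_).symm
    · intro ρ hρ
      rcases Finset.mem_insert.1 hρ with rfl | hρ
      · exact hX _ (hπ ▸ Finset.erase_subset _ _) (Finset.erase_subset _ _)
      · rw [Finset.mem_singleton.1 hρ]
        exact hX _ (hπ' ▸ Finset.erase_subset _ _) (Finset.erase_subset _ _)
    · intro ρ _ hρ
      by_contra hne
      obtain ⟨x, hx, rfl⟩ := exists_erase_of_inc_ne_zero (left_ne_zero_of_mul hne)
      have hxπ : x ∉ π := fun h =>
        Finset.notMem_erase x τ (subset_of_inc_ne_zero (right_ne_zero_of_mul hne) h)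
      have : x ∈ τ \ π := Finset.mem_sdiff.2 ⟨hx, hxπ⟩
      rw [h2] at this
      simp only [Finset.mem_insert, Finset.mem_singleton] at this
      rcases this with rfl | rfl <;> simp at hρ
  · refine Finset.sum_eq_zero fun ρ _ => ?_
    by_contra hne
    have h1 := left_ne_zero_of_mul hne
    have h2 := right_ne_zero_of_mul hne
    refine h ⟨(subset_of_inc_ne_zero h2).trans (subset_of_inc_ne_zero h1), ?_⟩
    rw [card_of_inc_ne_zero h1, card_of_inc_ne_zero h2]

variable (R : Type*) {G : Type*} [CommRing R] [AddCommGroup G] [Module R G]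

/-- Incidence numbers as a matrix over `R` whose row `ρ` and column `τ` holds the coefficient of `ρ`
in `∂ τ`. -/
def incMat (ρ τ : Finset V) : R := (inc τ ρ : R)

variable {R}

lemma inc_ne_zero_of_incMat (h : incMat R ρ τ ≠ 0) : inc τ ρ ≠ 0 := by
  rintro h0; exact h (by simp [incMat, h0])

lemma incMat_sq {X : Finset (Finset V)} (hX : ∀ ρ, π ⊆ ρ → ρ ⊆ τ → ρ ∈ X) :
    ∑ ρ ∈ X, incMat R π ρ * incMat R ρ τ = 0 := by
  have := congrArg (Int.cast : ℤ → R) (inc_sq hX)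
  push_cast at this
  simpa [incMat, mul_comm] using this

lemma isUnit_incMat (h : ρ ⊆ τ) (hc : #τ = #ρ + 1) : IsUnit (incMat R ρ τ) := by
  rcases inc_eq_one_or h hc with h | h <;> simp [incMat, h]

/-- The simplicial cochains of an interval `[σ, τ]` with `σ ≠ τ` are exact: adding and removing a
vertex `v ∈ τ \ σ` pairs off the cells. -/
lemma isExact_Icc (h : σ ⊆ τ) (hne : σ ≠ τ) (c : ℕ) :
    IsExact G (fun ρ' ρ : Finset V => (-1 : R) ^ (#ρ + c) * incMat R ρ ρ') (Finset.Icc σ τ) := by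
  obtain ⟨v, hvτ, hvσ⟩ : ∃ v ∈ τ, v ∉ σ := by
    by_contra! h'
    exact hne (h.antisymm h')
  refine IsExact.of_filtration (α := (Finset V)ᵒᵈ)
    (fun ρ => OrderDual.toDual (insert v ρ)) ?_ ?_ ?_
  · intro i hi j hj
    rw [Finset.mem_Icc] at hi hj
    have := incMat_sq (R := R) (π := j) (τ := i) (X := Finset.Icc σ τ) fun ρ h1 h2 =>
      Finset.mem_Icc.2 ⟨hj.1.trans h1, h2.trans hi.2⟩
    rw [← mul_zero ((-1 : R) ^ (#j + 1 + c) * (-1 : R) ^ (#j + c)), ← this, Finset.mul_sum]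
    refine Finset.sum_congr rfl fun k _ => ?_
    by_cases hk : incMat R j k = 0
    · simp [hk]
    · dsimp only
      rw [card_of_inc_ne_zero (inc_ne_zero_of_incMat hk)]; ring
  · intro i _ j _ hM
    exact Finset.insert_subset_insert v
      (subset_of_inc_ne_zero (inc_ne_zero_of_incMat (right_ne_zero_of_mul hM)))
  · intro a
    obtain ⟨b, rfl⟩ := OrderDual.toDual.surjective a
    simp only [OrderDual.toDual_inj]
    by_cases ha : v ∈ b ∧ σ ⊆ b ∧ b ⊆ τ
    · obtain ⟨hvb, hσb, hbτ⟩ := ha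
      have hfib : ({ρ ∈ Finset.Icc σ τ | insert v ρ = b} : Finset (Finset V)) =
          {b, b.erase v} := by
        ext ρ
        simp only [Finset.mem_filter, Finset.mem_Icc, Finset.mem_insert, Finset.mem_singleton]
        constructor
        · rintro ⟨-, rfl⟩
          by_cases hvρ : v ∈ ρ
          · exact Or.inl (Finset.insert_eq_of_mem hvρ).symm
          · exact Or.inr (Finset.erase_insert hvρ).symm
        · rintro (rfl | rfl)
          · exact ⟨⟨hσb, hbτ⟩, Finset.insert_eq_of_mem hvb⟩
          · exact ⟨⟨Finset.subset_erase.2 ⟨hσb, hvσ⟩, (Finset.erase_subset _ _).trans hbτ⟩,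
              Finset.insert_erase hvb⟩
      have hcard := Finset.card_erase_add_one hvb
      rw [hfib]
      refine isExact_pair (fun h => Finset.notMem_erase v b (h ▸ hvb)) ?_ ?_ ?_ ?_
      · simp [incMat, inc_self]
      · simp [incMat, inc_self]
      · by_contra hM
        have := card_of_inc_ne_zero (inc_ne_zero_of_incMat (right_ne_zero_of_mul hM))
        omega
      · exact (isUnit_neg_one.pow _).mul (isUnit_incMat (Finset.erase_subset _ _) hcard.symm)
    · rw [Finset.filter_false_of_mem]
      · exact isExact_empty
      · rintro ρ hρ rfl
        rw [Finset.mem_Icc] at hρ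
        exact ha ⟨Finset.mem_insert_self _ _, hρ.1.trans (Finset.subset_insert _ _),
          Finset.insert_subset hvτ hρ.2⟩

end Incidence

/-! ### The double complex of nested pairs of simplices -/

section DoubleComplex

variable {V R G : Type*} [LinearOrder V] [CommRing R] [AddCommGroup G] [Module R G]

/-- The matrix of the simplicial boundary operator, with one more generator `none` whose
differential is the chain `e`. -/
def augInc (e : Finset V → R) : Option (Finset V) → Option (Finset V) → R
  | some ρ, some τ => incMat R ρ τ
  | some ρ, none => e ρ
  | none, _ => 0

/-- The number of vertices, where the generator `none` counts as one dimension higher than the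
facets. -/
def ocard (N : ℕ) : Option (Finset V) → ℕ
  | some τ => #τ
  | none => N + 2

/-- The total differential of the double complex spanned by pairs `(ρ, τ)`: the signed coboundary on
`ρ` plus the boundary, extended by the class `e`, on `τ`. -/
def dblMat (e : Finset V → R) (N : ℕ) (p q : Finset V × Option (Finset V)) : R :=
  (if p.2 = q.2 then (-1) ^ (#q.1 + ocard N q.2) * incMat R q.1 p.1 else 0) +
    if p.1 = q.1 then augInc e p.2 q.2 else 0

/-- The simplices of `K` that contain `σ`. They span the chains of `K` modulo those of `cost K σ`.
-/
def star (K : Finset (Finset V)) (σ : Finset V) : Finset (Finset V) := {τ ∈ K | σ ⊆ τ}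

lemma mem_star {K : Finset (Finset V)} {σ τ : Finset V} : τ ∈ star K σ ↔ τ ∈ K ∧ σ ⊆ τ :=
  Finset.mem_filter

/-- The cells of the double complex: the pairs `ρ ⊆ τ` of simplices over `σ`, and the pairs `(ρ,
none)` with `ρ ∉ B`. -/
def dblCells (K B : Finset (Finset V)) (σ : Finset V) :
    Finset (Finset V × Option (Finset V)) :=
  {p ∈ star K σ ×ˢ Finset.insertNone (star K σ) |
    (∀ τ ∈ p.2, p.1 ⊆ τ) ∧ (p.2 = none → p.1 ∉ B)}

/-- The double complex together with two cells: `none`, to which every diagonal cell `(ρ, ρ)` is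
mapped and which makes the row of `σ` exact, and `some none`, which augments the complex of the
cells `(ρ, none)` by the evaluation on `e`. The arrow from `some none` to `none` with coefficient
`1` cancels these two cells. -/
def fullMat (e : Finset V → R) (N : ℕ) :
    Option (Option (Finset V × Option (Finset V))) →
    Option (Option (Finset V × Option (Finset V))) → R
  | some (some p), some (some q) => dblMat e N p q
  | none, some (some q) => if q.2 = some q.1 then 1 else 0
  | some none, some (some q) => if q.2 = none then - e q.1 else 0
  | none, some none => 1
  | some (some _), some none => 0
  | some none, some none => 0
  | _, none => 0

/-- `e` is a fundamental class of the complex `K` modulo the subcomplex `B`: a combination of the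
simplices with `N + 1` vertices whose boundary lies in `B`. -/
structure IsFundamental (K B : Finset (Finset V)) (N : ℕ) (e : Finset V → R) : Prop where
  lower : ∀ τ ∈ K, ∀ ρ ⊆ τ, ρ ∈ K
  bd_subset : B ⊆ K
  bd_lower : ∀ τ ∈ B, ∀ ρ ⊆ τ, ρ ∈ B
  supp : ∀ ρ, e ρ ≠ 0 → ρ ∈ K ∧ #ρ = N + 1
  cycle : ∀ τ ∈ K, τ ∉ B → ∑ ρ ∈ K, incMat R τ ρ * e ρ = 0

variable {K B : Finset (Finset V)} {N : ℕ} {e : Finset V → R} {σ : Finset V}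

lemma dblMat_ne_zero {p q : Finset V × Option (Finset V)} (h : dblMat e N p q ≠ 0) :
    (p.2 = q.2 ∧ inc p.1 q.1 ≠ 0) ∨ (p.1 = q.1 ∧ augInc e p.2 q.2 ≠ 0) := by
  by_contra! hc
  refine h ?_
  rw [dblMat]
  split_ifs with h1 h2 h2
  · simp [incMat, hc.1 h1, hc.2 h2]
  · simp [incMat, hc.1 h1]
  · simp [hc.2 h2]
  · simp

lemma exists_of_augInc_ne_zero {t u : Option (Finset V)} (h : augInc e t u ≠ 0) :
    ∃ τ, t = some τ ∧ ∀ τ' ∈ u, τ ⊆ τ' := by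
  cases t with
  | none => exact absurd rfl h
  | some τ =>
    refine ⟨τ, rfl, fun τ' hτ' => ?_⟩
    rw [Option.mem_def] at hτ'
    subst hτ'
    exact subset_of_inc_ne_zero (inc_ne_zero_of_incMat h)

lemma IsFundamental.ocard_eq (H : IsFundamental K B N e) {t u : Option (Finset V)}
    (h : augInc e t u ≠ 0) : ocard N u = ocard N t + 1 := by
  match t, u with
  | none, _ => exact absurd rfl h
  | some ρ, some τ => exact card_of_inc_ne_zero (inc_ne_zero_of_incMat h)
  | some ρ, none => simp only [ocard]; rw [(H.supp ρ h).2]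

lemma IsFundamental.cycle_star (H : IsFundamental K B N e) {τ : Finset V} (hτ : τ ∈ K)
    (hB : τ ∉ B) (hσ : σ ⊆ τ) : ∑ ρ ∈ star K σ, incMat R τ ρ * e ρ = 0 := by
  rw [← H.cycle τ hτ hB]
  refine Finset.sum_subset (Finset.filter_subset _ _) fun ρ hρ hn => ?_
  by_contra hne
  exact hn (mem_star.2 ⟨hρ, hσ.trans (subset_of_inc_ne_zero
    (inc_ne_zero_of_incMat (left_ne_zero_of_mul hne)))⟩)

lemma IsFundamental.incMat_sq (H : IsFundamental K B N e) {π τ : Finset V} (hσ : σ ⊆ π)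
    (hτ : τ ∈ K) : ∑ ρ ∈ star K σ, incMat R π ρ * incMat R ρ τ = 0 :=
  Augmental.incMat_sq fun ρ h1 h2 => mem_star.2 ⟨H.lower τ hτ ρ h2, hσ.trans h1⟩

lemma mem_dblCells_some {ρ τ : Finset V} :
    (ρ, some τ) ∈ dblCells K B σ ↔ ρ ∈ star K σ ∧ τ ∈ star K σ ∧ ρ ⊆ τ := by
  simp [dblCells, and_assoc]

lemma mem_dblCells_none {ρ : Finset V} :
    (ρ, none) ∈ dblCells K B σ ↔ ρ ∈ star K σ ∧ ρ ∉ B := by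
  simp [dblCells]

lemma IsFundamental.augInc_sq (H : IsFundamental K B N e) {ρ : Finset V}
    {t u : Option (Finset V)} (ht : (ρ, t) ∈ dblCells K B σ) (hu : (ρ, u) ∈ dblCells K B σ) :
    ∑ s ∈ Finset.insertNone (star K σ), augInc e t s * augInc e s u = 0 := by
  rw [Finset.sum_insertNone]
  match t, u with
  | none, _ => simp [augInc]
  | some π, some τ =>
    rw [mem_dblCells_some] at ht hu
    simpa [augInc] using H.incMat_sq (mem_star.1 ht.2.1).2 (mem_star.1 hu.2.1).1
  | some π, none =>
    rw [mem_dblCells_some] at ht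
    rw [mem_dblCells_none] at hu
    simpa [augInc] using H.cycle_star (mem_star.1 ht.2.1).1
      (fun h => hu.2 (H.bd_lower _ h _ ht.2.2)) (mem_star.1 ht.2.1).2

/-- The set `dblCells` is convex in the set of all pairs: a path of two nonzero entries between
cells stays in it. -/
lemma IsFundamental.mem_dblCells (H : IsFundamental K B N e)
    {p q k : Finset V × Option (Finset V)}
    (hp : p ∈ dblCells K B σ) (hq : q ∈ dblCells K B σ)
    (hk : k ∈ star K σ ×ˢ Finset.insertNone (star K σ))
    (hpk : dblMat e N p k ≠ 0) (hkq : dblMat e N k q ≠ 0) : k ∈ dblCells K B σ := by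
  refine Finset.mem_filter.2 ⟨hk, fun τ hτ => ?_, fun hkn => ?_⟩
  · have hp' := (Finset.mem_filter.1 hp).2.1
    rcases dblMat_ne_zero hpk with ⟨h1, h2⟩ | ⟨h1, h2⟩
    · exact (subset_of_inc_ne_zero h2).trans (hp' τ (h1 ▸ hτ))
    · obtain ⟨π, hπ, h3⟩ := exists_of_augInc_ne_zero h2
      exact h1 ▸ (hp' π hπ).trans (h3 τ hτ)
  · rcases dblMat_ne_zero hkq with ⟨h1, h2⟩ | ⟨h1, h2⟩
    · exact fun hB => (Finset.mem_filter.1 hq).2.2 (h1 ▸ hkn)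
        (H.bd_lower _ hB _ (subset_of_inc_ne_zero h2))
    · obtain ⟨π, hπ, -⟩ := exists_of_augInc_ne_zero h2
      rw [hkn] at hπ
      exact absurd hπ (by simp)

lemma IsFundamental.sqZero_dblMat (H : IsFundamental K B N e) :
    SqZero (dblMat e N) (dblCells K B σ) := by
  rintro ⟨ρ'', t''⟩ hp ⟨ρ, t⟩ hq
  have hsub : dblCells K B σ ⊆ star K σ ×ˢ Finset.insertNone (star K σ) :=
    Finset.filter_subset _ _
  rw [Finset.sum_subset hsub]
  swap
  · intro k hk hk'
    by_contra hne
    exact hk' (H.mem_dblCells hp hq hk (left_ne_zero_of_mul hne) (right_ne_zero_of_mul hne))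
  have hp1 := Finset.mem_product.1 (Finset.mem_filter.1 hp).1
  have hq1 := Finset.mem_product.1 (Finset.mem_filter.1 hq).1
  dsimp only at hp1 hq1
  rw [Finset.sum_product]
  have hite : ∀ (p : Prop) [Decidable p] (f : Option (Finset V) → R),
      (∑ t ∈ Finset.insertNone (star K σ), if p then f t else 0) =
        if p then ∑ t ∈ Finset.insertNone (star K σ), f t else 0 := by
    intro p _ f; split_ifs <;> simp
  simp only [dblMat, add_mul, mul_add, ite_mul, mul_ite, zero_mul, mul_zero,
    Finset.sum_add_distrib, hite, Finset.sum_ite_eq, Finset.sum_ite_eq', hp1, hq1, if_true]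
  have h1 : ∑ x ∈ star K σ, (if t'' = t then (-1) ^ (#x + ocard N t) * incMat R x ρ'' *
      ((-1) ^ (#ρ + ocard N t) * incMat R ρ x) else 0) = 0 := by
    split_ifs
    · have := H.incMat_sq (mem_star.1 hq1.1).2 (mem_star.1 hp1.1).1
      rw [← mul_zero ((-1 : R) ^ (#ρ + 1 + ocard N t) * (-1) ^ (#ρ + ocard N t)), ← this,
        Finset.mul_sum]
      refine Finset.sum_congr rfl fun x _ => ?_
      by_cases hx : incMat R ρ x = 0
      · simp [hx]
      · rw [card_of_inc_ne_zero (inc_ne_zero_of_incMat hx)]; ring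
    · simp
  have h2 : (if ρ'' = ρ then ∑ s ∈ Finset.insertNone (star K σ),
      augInc e t'' s * augInc e s t else 0) = 0 := by
    split_ifs with h
    · subst h; exact H.augInc_sq hp hq
    · rfl
  rw [h1, h2, zero_add, add_zero]
  by_cases h : augInc e t'' t = 0
  · simp [h]
  · rw [H.ocard_eq h]; ring

lemma IsFundamental.sqZero_fullMat (H : IsFundamental K B N e) :
    SqZero (fullMat e N) (Finset.insertNone (Finset.insertNone (dblCells K B σ))) := by
  intro i hi j hj
  rw [Finset.sum_insertNone, Finset.sum_insertNone]
  match i, j with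
  | _, none => simp [fullMat]
  | none, some none => simp [fullMat]
  | some none, some none => simp [fullMat]
  | some (some p), some none => simp [fullMat]
  | some (some p), some (some q) =>
    simp only [fullMat, zero_mul, zero_add]
    exact H.sqZero_dblMat p (Finset.some_mem_insertNone.1 (Finset.some_mem_insertNone.1 hi)) q
      (Finset.some_mem_insertNone.1 (Finset.some_mem_insertNone.1 hj))
  | some none, some (some (ρ, t)) =>
    simp only [fullMat, zero_mul, zero_add]
    have hq : (ρ, t) ∈ dblCells K B σ := by simpa using hj
    cases t with
    | some τ =>
      refine Finset.sum_eq_zero fun k _ => ?_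
      by_contra hne
      have h1 := left_ne_zero_of_mul hne
      have h2 := right_ne_zero_of_mul hne
      have hk : k.2 = none := by by_contra h; exact h1 (if_neg h)
      rcases dblMat_ne_zero h2 with ⟨h3, -⟩ | ⟨-, h3⟩
      · rw [hk] at h3; exact absurd h3 (by simp)
      · rw [hk] at h3; exact h3 rfl
    | none =>
      rw [mem_dblCells_none] at hq
      have hφ : Function.Injective fun ρ' : Finset V => (ρ', (none : Option (Finset V))) :=
        fun a b h => (Prod.ext_iff.1 h).1
      rw [← Finset.sum_subset (s₁ := (star K σ \ B).map ⟨_, hφ⟩), Finset.sum_map]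
      · have := H.cycle_star (mem_star.1 hq.1).1 hq.2 (mem_star.1 hq.1).2
        rw [← mul_zero (-(-1 : R) ^ (#ρ + (N + 2))), ← this, Finset.mul_sum]
        refine Finset.sum_subset_zero_on_sdiff Finset.sdiff_subset ?_ ?_
        · intro x hx
          have hxB : x ∈ B := by
            simp only [Finset.mem_sdiff, not_and, not_not] at hx; exact hx.2 hx.1
          by_cases h : incMat R ρ x = 0
          · simp [h]
          · exact absurd (H.bd_lower x hxB ρ
              (subset_of_inc_ne_zero (inc_ne_zero_of_incMat h))) hq.2
        · intro x _
          simp only [Function.Embedding.coeFn_mk, if_true, dblMat, augInc, ocard, ite_self,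
            add_zero]
          ring
      · intro k hk
        obtain ⟨x, hx, rfl⟩ := Finset.mem_map.1 hk
        rw [Finset.mem_sdiff] at hx
        exact mem_dblCells_none.2 hx
      · rintro ⟨x, t⟩ hk hk'
        rw [if_neg, zero_mul]
        intro ht
        dsimp only at ht
        subst ht
        rw [mem_dblCells_none] at hk
        exact hk' (Finset.mem_map.2 ⟨x, Finset.mem_sdiff.2 hk, rfl⟩)
  | none, some (some (ρ, t)) =>
    simp only [fullMat, zero_mul, zero_add, one_mul]
    have hq : (ρ, t) ∈ dblCells K B σ := by simpa using hj
    have hφ : Function.Injective fun ρ' : Finset V => (ρ', some ρ') :=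
        fun a b h => (Prod.ext_iff.1 h).1
    have hρ : ρ ∈ star K σ := (Finset.mem_product.1 (Finset.mem_filter.1 hq).1).1
    rw [← Finset.sum_subset (s₁ := (star K σ).map ⟨_, hφ⟩), Finset.sum_map]
    · simp only [Function.Embedding.coeFn_mk, if_true, one_mul, dblMat, Finset.sum_add_distrib]
      rw [Finset.sum_ite_eq' _ ρ, if_pos hρ]
      cases t with
      | none => simp [augInc]
      | some τ =>
        rw [mem_dblCells_some] at hq
        simp only [Option.some.injEq]
        rw [Finset.sum_ite_eq' _ τ, if_pos hq.2.1]
        simp only [reduceCtorEq, if_false, zero_add, augInc, ocard]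
        by_cases h : incMat R ρ τ = 0
        · simp [h]
        · rw [card_of_inc_ne_zero (inc_ne_zero_of_incMat h)]
          have : (-1 : R) ^ (#ρ + (#ρ + 1)) = -1 := Odd.neg_one_pow ⟨#ρ, by ring⟩
          rw [this]; ring
    · intro k hk
      obtain ⟨x, hx, rfl⟩ := Finset.mem_map.1 hk
      exact mem_dblCells_some.2 ⟨hx, hx, subset_rfl⟩
    · rintro ⟨x, t⟩ hk hk'
      rw [if_neg, zero_mul]
      intro ht
      dsimp only at ht
      subst ht
      rw [mem_dblCells_some] at hk
      exact hk' (Finset.mem_map.2 ⟨x, hk.1, rfl⟩)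

end DoubleComplex

/-! ### Exactness of the rows and columns -/

section RowsColumns

variable {V R G : Type*} [LinearOrder V] [CommRing R] [AddCommGroup G] [Module R G]
variable {K B : Finset (Finset V)} {N : ℕ} {e : Finset V → R} {σ : Finset V}

/-- The total complex is exact, since its columns are. -/
lemma IsFundamental.isExact_dblMat (H : IsFundamental K B N e)
    (hB : ∀ ρ ∈ B, IsExact G (incMat R) (star K ρ))
    (hI : ∀ ρ ∈ K, ρ ∉ B → IsExact G (augInc e) (Finset.insertNone (star K ρ))) :
    IsExact G (dblMat e N) (dblCells K B σ) := by
  refine IsExact.of_filtration (α := (Finset V)ᵒᵈ) (fun p => OrderDual.toDual p.1)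
    H.sqZero_dblMat ?_ ?_
  · intro p _ q _ hM
    rcases dblMat_ne_zero hM with ⟨-, h⟩ | ⟨h, -⟩
    · exact subset_of_inc_ne_zero h
    · exact h.ge
  · intro a
    obtain ⟨ρ, rfl⟩ := OrderDual.toDual.surjective a
    simp only [OrderDual.toDual_inj]
    by_cases hρ : ρ ∈ star K σ
    · have hstar : ∀ τ, τ ∈ star K σ ∧ ρ ⊆ τ ↔ τ ∈ star K ρ := fun τ => by
        simp only [mem_star]
        exact ⟨fun h => ⟨h.1.1, h.2⟩, fun h => ⟨⟨h.1, (mem_star.1 hρ).2.trans h.2⟩, h.2⟩⟩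
      by_cases hρB : ρ ∈ B
      · have hφ : Function.Injective fun τ : Finset V => (ρ, some τ) :=
          fun a b h => Option.some_injective _ (Prod.ext_iff.1 h).2
        have hfib : ({p ∈ dblCells K B σ | p.1 = ρ} : Finset _) = (star K ρ).map ⟨_, hφ⟩ := by
          ext ⟨ρ', t⟩
          simp only [Finset.mem_filter, Finset.mem_map, Function.Embedding.coeFn_mk,
            Prod.mk.injEq]
          constructor
          · rintro ⟨h1, rfl⟩
            cases t with
            | none => exact absurd hρB (mem_dblCells_none.1 h1).2
            | some τ => exact ⟨τ, (hstar τ).1 (mem_dblCells_some.1 h1).2, rfl, rfl⟩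
          · rintro ⟨τ, hτ, rfl, rfl⟩
            exact ⟨mem_dblCells_some.2 ⟨hρ, (hstar τ).2 hτ⟩, rfl⟩
        rw [hfib]
        refine IsExact.map _ ((hB ρ hρB).congr fun i _ j _ => ?_)
        simp [dblMat, incMat, inc_self, augInc]
      · have hφ : Function.Injective fun t : Option (Finset V) => (ρ, t) :=
          fun a b h => (Prod.ext_iff.1 h).2
        have hfib : ({p ∈ dblCells K B σ | p.1 = ρ} : Finset _) =
            (Finset.insertNone (star K ρ)).map ⟨_, hφ⟩ := by
          ext ⟨ρ', t⟩
          simp only [Finset.mem_filter, Finset.mem_map, Function.Embedding.coeFn_mk,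
            Prod.mk.injEq]
          constructor
          · rintro ⟨h1, rfl⟩
            refine ⟨t, ?_, rfl, rfl⟩
            cases t with
            | none => exact Finset.none_mem_insertNone
            | some τ =>
              exact Finset.some_mem_insertNone.2 ((hstar τ).1 (mem_dblCells_some.1 h1).2)
          · rintro ⟨t, ht, rfl, rfl⟩
            refine ⟨?_, rfl⟩
            cases t with
            | none => exact mem_dblCells_none.2 ⟨hρ, hρB⟩
            | some τ =>
              exact mem_dblCells_some.2 ⟨hρ, (hstar τ).2 (Finset.some_mem_insertNone.1 ht)⟩
        rw [hfib]
        refine IsExact.map _ ((hI ρ (mem_star.1 hρ).1 hρB).congr fun i _ j _ => ?_)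
        simp [dblMat, incMat, inc_self]
    · rw [Finset.filter_false_of_mem]
      · exact isExact_empty
      · rintro p hp rfl
        exact hρ (Finset.mem_product.1 (Finset.mem_filter.1 hp).1).1

/-- The row in which a cell of `simplexCells` lies; the cell `none` belongs to the row of `σ`. -/
def rowIndex (σ : Finset V) :
    Option (Option (Finset V × Option (Finset V))) → Finset V
  | some (some (_, some τ)) => τ
  | _ => σ

/-- The inclusion of the cells of the double complex into those of `fullMat`. -/
def cellEmb : (Finset V × Option (Finset V)) ↪
    Option (Option (Finset V × Option (Finset V))) :=
  Function.Embedding.some.trans Function.Embedding.some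

/-- The cell `none` and the pairs `(ρ, τ)` with `τ` a simplex: a subcomplex, filtered by the rows.
-/
def simplexCells (K B : Finset (Finset V)) (σ : Finset V) :
    Finset (Option (Option (Finset V × Option (Finset V)))) :=
  insert none ({p ∈ dblCells K B σ | p.2 ≠ none}.map cellEmb)

/-- The cell `some none` and the pairs `(ρ, none)`: the augmented cochain complex of the simplices
over `σ` that are not in `B`, as a quotient of the full complex. -/
def classCells (K B : Finset (Finset V)) (σ : Finset V) :
    Finset (Option (Option (Finset V × Option (Finset V)))) :=
  insert (some none) ({p ∈ dblCells K B σ | p.2 = none}.map cellEmb)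

lemma mem_simplexCells {ρ : Finset V} {t : Option (Finset V)} :
    some (some (ρ, t)) ∈ simplexCells K B σ ↔ (ρ, t) ∈ dblCells K B σ ∧ t ≠ none := by
  simp [simplexCells, cellEmb]

lemma mem_classCells {ρ : Finset V} {t : Option (Finset V)} :
    some (some (ρ, t)) ∈ classCells K B σ ↔ (ρ, t) ∈ dblCells K B σ ∧ t = none := by
  simp [classCells, cellEmb]

lemma simplexCells_union : simplexCells K B σ ∪ classCells K B σ =
    Finset.insertNone (Finset.insertNone (dblCells K B σ)) := by
  ext (_ | _ | ⟨ρ, t⟩)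
  · simp [simplexCells]
  · simp [classCells]
  · rw [Finset.mem_union, mem_simplexCells, mem_classCells, Finset.some_mem_insertNone,
      Finset.some_mem_insertNone]
    tauto

lemma disjoint_simplexCells : Disjoint (simplexCells K B σ) (classCells K B σ) := by
  rw [Finset.disjoint_left]
  rintro (_ | _ | ⟨ρ, t⟩) h1 h2
  · simp [classCells, cellEmb] at h2
  · simp [simplexCells, cellEmb] at h1
  · exact (mem_simplexCells.1 h1).2 (mem_classCells.1 h2).2

lemma fullMat_class_simplex {i j : Option (Option (Finset V × Option (Finset V)))}
    (hi : i ∈ classCells K B σ) (hj : j ∈ simplexCells K B σ) : fullMat e N i j = 0 := by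
  match i, j with
  | _, none => simp [fullMat]
  | none, some _ => simp [classCells, cellEmb] at hi
  | _, some none => simp [simplexCells, cellEmb] at hj
  | some none, some (some (ρ, t)) =>
    rw [mem_simplexCells] at hj
    simp [fullMat, hj.2]
  | some (some (ρ', t')), some (some (ρ, t)) =>
    rw [mem_simplexCells] at hj
    rw [mem_classCells] at hi
    obtain ⟨-, rfl⟩ := hi
    simp [fullMat, dblMat, hj.2.symm, augInc]

lemma IsFundamental.isExact_simplexCells (H : IsFundamental K B N e) (hσ : σ ∈ K) :
    IsExact G (fullMat e N) (simplexCells K B σ) := by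
  have hsq : SqZero (fullMat e N) (simplexCells K B σ) := by
    refine (H.sqZero_fullMat (σ := σ)).mono ?_ ?_
    · rw [← simplexCells_union]; exact Finset.subset_union_left
    · intro i _ j hj k hk _ hkj
      rw [← simplexCells_union] at hk
      rcases Finset.mem_union.1 hk with hk | hk
      · exact hk
      · exact absurd (fullMat_class_simplex hk hj) hkj
  have hσσ : σ ∈ star K σ := mem_star.2 ⟨hσ, subset_rfl⟩
  refine IsExact.of_filtration (rowIndex σ) hsq ?_ ?_
  · intro i hi j hj hM
    match i, j with
    | _, none => simp [fullMat] at hM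
    | some none, _ => simp [simplexCells, cellEmb] at hi
    | _, some none => simp [simplexCells, cellEmb] at hj
    | some (some (ρ', none)), _ => simp [mem_simplexCells] at hi
    | _, some (some (ρ, none)) => simp [mem_simplexCells] at hj
    | none, some (some (ρ, some τ)) =>
      rw [mem_simplexCells, mem_dblCells_some] at hj
      exact (mem_star.1 hj.1.2.1).2
    | some (some (ρ', some τ')), some (some (ρ, some τ)) =>
      rcases dblMat_ne_zero hM with ⟨h, -⟩ | ⟨-, h⟩
      · exact (Option.some_injective _ h).le
      · exact subset_of_inc_ne_zero (inc_ne_zero_of_incMat h)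
  · intro τ
    by_cases hτ : τ ∈ star K σ
    swap
    · rw [Finset.filter_false_of_mem]
      · exact isExact_empty
      · rintro i hi rfl
        match i with
        | none => exact hτ hσσ
        | some none => exact hτ hσσ
        | some (some (ρ, none)) => exact hτ hσσ
        | some (some (ρ, some τ)) =>
          rw [mem_simplexCells, mem_dblCells_some] at hi
          exact hτ hi.1.2.1
    by_cases hτσ : σ = τ
    · subst hτσ
      have hfib : {i ∈ simplexCells K B σ | rowIndex σ i = σ} =
          {none, some (some (σ, some σ))} := by
        ext i
        rw [Finset.mem_filter, Finset.mem_insert, Finset.mem_singleton]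
        match i with
        | none => simp [simplexCells, rowIndex]
        | some none => simp [simplexCells, cellEmb]
        | some (some (ρ, none)) => simp [mem_simplexCells]
        | some (some (ρ, some τ)) =>
          rw [mem_simplexCells, mem_dblCells_some]
          simp only [rowIndex, Option.some.injEq, Prod.mk.injEq, reduceCtorEq, false_or]
          constructor
          · rintro ⟨⟨⟨h1, h2, h3⟩, -⟩, rfl⟩
            exact ⟨h3.antisymm (mem_star.1 h1).2, rfl⟩
          · rintro ⟨rfl, rfl⟩
            exact ⟨⟨⟨hσσ, hσσ, subset_rfl⟩, by simp⟩, rfl⟩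
      rw [hfib]
      refine isExact_pair (by simp) ?_ ?_ ?_ ?_ <;>
        simp [fullMat, dblMat, incMat, inc_self, augInc]
    · have hφ : Function.Injective fun ρ : Finset V => some (some (ρ, some τ)) := fun a b h =>
        (Prod.ext_iff.1 (Option.some_injective _ (Option.some_injective _ h))).1
      have hfib : {i ∈ simplexCells K B σ | rowIndex σ i = τ} =
          (Finset.Icc σ τ).map ⟨_, hφ⟩ := by
        ext i
        rw [Finset.mem_filter, Finset.mem_map]
        simp only [Function.Embedding.coeFn_mk, Finset.mem_Icc]
        match i with
        | none => simp [simplexCells, rowIndex, hτσ]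
        | some none => simp [simplexCells, cellEmb]
        | some (some (ρ, none)) => simp [mem_simplexCells]
        | some (some (ρ, some τ')) =>
          rw [mem_simplexCells, mem_dblCells_some]
          simp only [rowIndex, Option.some.injEq, Prod.mk.injEq]
          constructor
          · rintro ⟨⟨⟨h1, h2, h3⟩, -⟩, rfl⟩
            exact ⟨ρ, ⟨(mem_star.1 h1).2, h3⟩, rfl, rfl⟩
          · rintro ⟨ρ, ⟨h1, h2⟩, rfl, rfl⟩
            exact ⟨⟨⟨mem_star.2 ⟨H.lower _ (mem_star.1 hτ).1 _ h2, h1⟩, hτ, h2⟩, by simp⟩, rfl⟩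
      rw [hfib]
      refine IsExact.map _ ((isExact_Icc (mem_star.1 hτ).2 hτσ #τ).congr fun i _ j _ => ?_)
      simp [fullMat, dblMat, augInc, incMat, inc_self, ocard]

lemma IsFundamental.isExact_fullMat (H : IsFundamental K B N e)
    (hB : ∀ ρ ∈ B, IsExact G (incMat R) (star K ρ))
    (hI : ∀ ρ ∈ K, ρ ∉ B → IsExact G (augInc e) (Finset.insertNone (star K ρ))) :
    IsExact G (fullMat e N) (Finset.insertNone (Finset.insertNone (dblCells K B σ))) := by
  have hU : {none, some none} ∪ (dblCells K B σ).map cellEmb =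
      Finset.insertNone (Finset.insertNone (dblCells K B σ)) := by
    ext (_ | _ | p)
    · simp
    · simp
    · rw [Finset.some_mem_insertNone, Finset.some_mem_insertNone]
      simp [cellEmb]
  rw [← hU]
  refine IsExact.union ?_ ?_ ?_ ?_ ?_
  · rw [Finset.disjoint_left]
    intro i hi hi'
    obtain ⟨p, -, rfl⟩ := Finset.mem_map.1 hi'
    simp [cellEmb] at hi
  · intro i hi j hj
    obtain ⟨p, -, rfl⟩ := Finset.mem_map.1 hi
    simp only [Finset.mem_insert, Finset.mem_singleton] at hj
    rcases hj with rfl | rfl <;> rfl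
  · rw [hU]; exact H.sqZero_fullMat
  · exact isExact_pair (by simp) rfl rfl rfl isUnit_one
  · exact IsExact.map _ (H.isExact_dblMat hB hI)

/-- Lefschetz duality around `σ`, in the form of an exact complex: the chains of `K` modulo `B`
around `σ`, augmented by the fundamental class. -/
lemma IsFundamental.isExact_interior [IsDomain R] [IsPrincipalIdealRing R]
    (H : IsFundamental K B N e)
    (hB : ∀ ρ ∈ B, IsExact G (incMat R) (star K ρ))
    (hI : ∀ ρ ∈ K, ρ ∉ B → IsExact G (augInc e) (Finset.insertNone (star K ρ)))
    (hσ : σ ∈ K) :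
    IsExact G (augInc e) (Finset.insertNone (star K σ \ B)) := by
  have h1 : IsExact G (fullMat e N) (classCells K B σ) := by
    refine IsExact.quotient disjoint_simplexCells
      (fun i hi j hj => fullMat_class_simplex hi hj) ?_ ?_ (H.isExact_simplexCells hσ)
    · rw [simplexCells_union]; exact H.sqZero_fullMat
    · rw [simplexCells_union]; exact H.isExact_fullMat hB hI
  have hφ : Function.Injective fun t : Option (Finset V) =>
      some (t.map fun ρ => (ρ, (none : Option (Finset V)))) := fun a b h =>
    Option.map_injective (fun x y h => (Prod.ext_iff.1 h).1) (Option.some_injective _ h)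
  have h2 : classCells K B σ = (Finset.insertNone (star K σ \ B)).map ⟨_, hφ⟩ := by
    ext i
    rw [Finset.mem_map]
    simp only [Function.Embedding.coeFn_mk]
    match i with
    | none => simp [classCells, cellEmb]
    | some none =>
      simp only [classCells, Finset.mem_insert, true_or, true_iff]
      exact ⟨none, by simp⟩
    | some (some (ρ, some τ)) =>
      rw [mem_classCells]
      simp only [reduceCtorEq, and_false, false_iff, not_exists, not_and]
      rintro (_ | ρ) - <;> simp
    | some (some (ρ, none)) =>
      rw [mem_classCells, mem_dblCells_none]
      constructor
      · rintro ⟨h, -⟩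
        exact ⟨some ρ, Finset.some_mem_insertNone.2 (Finset.mem_sdiff.2 h), rfl⟩
      · rintro ⟨_ | ρ', h, h'⟩
        · simp at h'
        · simp only [Option.map_some, Option.some.injEq, Prod.mk.injEq, and_true] at h'
          subst h'
          exact ⟨Finset.mem_sdiff.1 (Finset.some_mem_insertNone.1 h), rfl⟩
  rw [h2] at h1
  -- the signs by which the coboundary enters the double complex
  set w : Option (Finset V) → R := fun t => t.elim 1 fun ρ => (-1) ^ (#ρ + N)
  have h3 : IsExact G (fun i j => augInc e j i) (Finset.insertNone (star K σ \ B)) := by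
    refine IsExact.untwist (w := w) ?_ ?_ (h1.comap.congr ?_)
    · rintro (_ | ρ) _
      · simp [w]
      · simp only [w, Option.elim]
        rw [← pow_add]; exact Even.neg_one_pow ⟨_, rfl⟩
    · intro i _ j _ hM
      match i, j with
      | _, none => exact absurd rfl hM
      | none, some ρ =>
        have : #ρ = N + 1 := (H.supp ρ hM).2
        simp only [w, Option.elim, this]
        rw [Odd.neg_one_pow ⟨N, by ring⟩, neg_neg]
      | some ρ', some ρ =>
        have := card_of_inc_ne_zero (inc_ne_zero_of_incMat hM)
        simp only [w, Option.elim, this]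
        ring
    · intro i _ j _
      match i, j with
      | none, none => simp [fullMat, augInc]
      | some ρ', none => simp [fullMat, augInc]
      | none, some ρ =>
        simp only [fullMat, augInc, w, Option.elim, Function.Embedding.coeFn_mk, Option.map_none,
          Option.map_some, if_true]
        by_cases h : e ρ = 0
        · simp [h]
        · rw [(H.supp ρ h).2, Odd.neg_one_pow ⟨N, by ring⟩, neg_one_mul]
      | some ρ', some ρ =>
        simp only [fullMat, augInc, w, Option.elim, Function.Embedding.coeFn_mk,
          Option.map_some, if_true, dblMat, ocard, ite_self, add_zero]
        ring
  refine h3.transpose ?_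
  intro i hi j hj
  have key : ∀ t ∈ Finset.insertNone (star K σ \ B), ∀ u ∈ Finset.insertNone (star K σ \ B),
      ∑ k ∈ Finset.insertNone (star K σ \ B), augInc e t k * augInc e k u = 0 := by
    intro t ht u hu
    match t, u with
    | none, _ => simp [augInc]
    | some π, u =>
      rw [Finset.some_mem_insertNone, Finset.mem_sdiff, mem_star] at ht
      rw [Finset.sum_insertNone]
      have hrest : ∑ k ∈ star K σ \ B, augInc e (some π) (some k) * augInc e (some k) u =
          ∑ k ∈ star K σ, augInc e (some π) (some k) * augInc e (some k) u := by
        refine Finset.sum_subset Finset.sdiff_subset fun k hk hkn => ?_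
        by_contra hne
        have hkB : k ∈ B := by by_contra h; exact hkn (Finset.mem_sdiff.2 ⟨hk, h⟩)
        exact ht.2 (H.bd_lower k hkB π
          (subset_of_inc_ne_zero (inc_ne_zero_of_incMat (left_ne_zero_of_mul hne))))
      rw [hrest]
      cases u with
      | none => simpa [augInc] using H.cycle_star ht.1.1 ht.2 ht.1.2
      | some τ =>
        rw [Finset.some_mem_insertNone, Finset.mem_sdiff, mem_star] at hu
        simpa [augInc] using H.incMat_sq ht.1.2 hu.1.1
  simpa only [mul_comm] using key j hj i hi

end RowsColumns

/-! ### From the interior to the boundary -/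

section Boundary

variable {V R G : Type*} [LinearOrder V] [CommRing R] [AddCommGroup G] [Module R G]
variable {K B : Finset (Finset V)} {N : ℕ} {e : Finset V → R} {σ : Finset V}

/-- The boundary of the chain `e` of `K`. -/
def bdClass (K : Finset (Finset V)) (e : Finset V → R) (τ : Finset V) : R :=
  ∑ ρ ∈ K, incMat R τ ρ * e ρ

/-- The boundary operator on simplices, with two more generators: `some none`, mapped to `e` minus
the generator `none`, and `none`, mapped to the boundary `b` of `e`. -/
def coneMat (e b : Finset V → R) :
    Option (Option (Finset V)) → Option (Option (Finset V)) → R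
  | some t, some u => augInc e t u
  | none, some none => -1
  | none, some (some _) => 0
  | some (some τ), none => b τ
  | some none, none => 0
  | none, none => 0

lemma bdClass_eq_sum_star {τ : Finset V} (hσ : σ ⊆ τ) :
    bdClass K e τ = ∑ ρ ∈ star K σ, incMat R τ ρ * e ρ := by
  refine (Finset.sum_subset (Finset.filter_subset _ _) fun ρ hρ hn => ?_).symm
  by_contra hne
  exact hn (mem_star.2 ⟨hρ, hσ.trans (subset_of_inc_ne_zero
    (inc_ne_zero_of_incMat (left_ne_zero_of_mul hne)))⟩)

lemma IsFundamental.sqZero_coneMat (H : IsFundamental K B N e) :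
    SqZero (coneMat e (bdClass K e)) (Finset.insertNone (Finset.insertNone (star K σ))) := by
  intro i hi j hj
  rw [Finset.sum_insertNone, Finset.sum_insertNone]
  match i with
  | none => cases j <;> simp [coneMat, augInc]
  | some none => cases j <;> simp [coneMat, augInc]
  | some (some π) =>
    have hπ : σ ⊆ π := by
      rw [Finset.some_mem_insertNone, Finset.some_mem_insertNone, mem_star] at hi; exact hi.2
    match j with
    | none =>
      simp only [coneMat, augInc, mul_zero, zero_add, bdClass, Finset.mul_sum]
      rw [Finset.sum_comm]
      refine Finset.sum_eq_zero fun F hF => ?_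
      rw [← zero_mul (e F), ← H.incMat_sq hπ hF, Finset.sum_mul]
      exact Finset.sum_congr rfl fun τ _ => by ring
    | some none =>
      simp [coneMat, augInc, bdClass_eq_sum_star (K := K) (e := e) hπ]
    | some (some τ) =>
      rw [Finset.some_mem_insertNone, Finset.some_mem_insertNone, mem_star] at hj
      simpa [coneMat, augInc] using H.incMat_sq hπ hj.1

/-- Around a simplex of `B`, the chains of `B` augmented by the boundary of the fundamental class
form an exact complex, if `K` has the local homology of a manifold with boundary `B`. -/
theorem IsFundamental.isExact_boundary [IsDomain R] [IsPrincipalIdealRing R]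
    (H : IsFundamental K B N e)
    (hB : ∀ ρ ∈ B, IsExact G (incMat R) (star K ρ))
    (hI : ∀ ρ ∈ K, ρ ∉ B → IsExact G (augInc e) (Finset.insertNone (star K ρ)))
    (hσ : σ ∈ B) :
    IsExact G (augInc (bdClass K e)) (Finset.insertNone (star B σ)) := by
  have hφ : Function.Injective fun t : Option (Finset V) => t.map (some : Finset V → _) :=
    Option.map_injective (Option.some_injective _)
  set Y := (Finset.insertNone (star B σ)).map ⟨_, hφ⟩ with hY
  set Z := (Finset.insertNone (star K σ \ B)).map (Function.Embedding.some) with hZ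
  have memY : ∀ {τ}, some (some τ) ∈ Y ↔ τ ∈ star B σ := fun {τ} => by
    rw [hY, Finset.mem_map]
    constructor
    · rintro ⟨_ | ρ, h, h'⟩
      · simp at h'
      · simp only [Function.Embedding.coeFn_mk, Option.map_some, Option.some.injEq] at h'
        exact h' ▸ Finset.some_mem_insertNone.1 h
    · exact fun h => ⟨some τ, Finset.some_mem_insertNone.2 h, rfl⟩
  have noneY : none ∈ Y := Finset.mem_map.2 ⟨none, by simp, rfl⟩
  have someNoneY : some none ∉ Y := by
    rw [hY, Finset.mem_map]
    rintro ⟨_ | ρ, h, h'⟩ <;> simp at h'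
  have memZ : ∀ {t}, some t ∈ Z ↔ t ∈ Finset.insertNone (star K σ \ B) := fun {t} =>
    Finset.mem_map' _
  have noneZ : none ∉ Z := by simp [hZ]
  have hYZ : Disjoint Y Z := by
    rw [Finset.disjoint_left]
    rintro (_ | _ | τ) h1 h2
    · exact noneZ h2
    · exact someNoneY h1
    · rw [memY, mem_star] at h1
      rw [memZ, Finset.some_mem_insertNone, Finset.mem_sdiff] at h2
      exact h2.2 h1.1
  have hU : Y ∪ Z = Finset.insertNone (Finset.insertNone (star K σ)) := by
    ext (_ | _ | τ)
    · simp [noneY]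
    · simp [memZ]
    · rw [Finset.mem_union, memY, memZ]
      simp only [Finset.some_mem_insertNone, Finset.mem_sdiff, mem_star]
      have := @H.bd_subset τ
      tauto
  have hc : ∀ i ∈ Z, ∀ j ∈ Y, coneMat e (bdClass K e) i j = 0 := by
    intro i hi j hj
    match i, j with
    | none, _ => exact absurd hi noneZ
    | _, some none => exact absurd hj someNoneY
    | some none, none => rfl
    | some none, some (some τ) => rfl
    | some (some π), none =>
      rw [memZ, Finset.some_mem_insertNone, Finset.mem_sdiff, mem_star] at hi
      exact H.cycle π hi.1.1 hi.2
    | some (some π), some (some τ) =>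
      rw [memZ, Finset.some_mem_insertNone, Finset.mem_sdiff, mem_star] at hi
      rw [memY, mem_star] at hj
      by_contra hne
      exact hi.2 (H.bd_lower τ hj.1 π (subset_of_inc_ne_zero (inc_ne_zero_of_incMat hne)))
  -- the two extra generators cancel, and the star of `σ` is exact
  have hwhole : IsExact G (coneMat e (bdClass K e))
      (Finset.insertNone (Finset.insertNone (star K σ))) := by
    set S := (star K σ).map (Function.Embedding.some.trans Function.Embedding.some)
    have hS : S ∪ {none, some none} =
        Finset.insertNone (Finset.insertNone (star K σ)) := by
      ext (_ | _ | τ)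
      · simp
      · simp
      · simp [S]
    rw [← hS]
    refine IsExact.union ?_ ?_ ?_ ?_ ?_
    · rw [Finset.disjoint_left]
      rintro (_ | _ | τ) h1 h2
      · simp [S] at h1
      · simp [S] at h1
      · simp at h2
    · intro i hi j hj
      obtain ⟨τ, -, rfl⟩ := Finset.mem_map.1 hj
      rw [Finset.mem_insert, Finset.mem_singleton] at hi
      rcases hi with rfl | rfl <;> rfl
    · rw [hS]; exact H.sqZero_coneMat
    · exact IsExact.map _ ((hB σ hσ).congr fun _ _ _ _ => rfl)
    · exact isExact_pair (by simp) rfl rfl rfl isUnit_one.neg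
  have hres := IsExact.sub hYZ hc (by rw [hU]; exact H.sqZero_coneMat)
    (by rw [hU]; exact hwhole)
    (IsExact.map _ ((H.isExact_interior hB hI (H.bd_subset hσ)).congr fun _ _ _ _ => rfl))
  refine hres.comap.congr fun i _ j _ => ?_
  match i, j with
  | none, none => rfl
  | none, some _ => rfl
  | some _, none => rfl
  | some _, some _ => rfl

end Boundary

/-! ### Relative homology in terms of incidence numbers -/

section RelativeHomology

variable {V A G : Type*} [LinearOrder V] [CommRing A] [AddCommGroup G] [Module A G]
variable {K L : Set (Finset V)} {X : Finset (Finset V)} {i : ℤ}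

lemma bdry_apply (c : Finset V →₀ G) {S : Finset (Finset V)} (hS : c.support ⊆ S)
    (ρ : Finset V) : bdry A G c ρ = ∑ τ ∈ S, inc τ ρ • c τ := by
  rw [bdry, Finsupp.lsum_apply, Finsupp.sum, Finset.sum_subset hS]
  · rw [Finsupp.finsetSum_apply]
    refine Finset.sum_congr rfl fun τ _ => ?_
    rw [LinearMap.sum_apply, Finsupp.finsetSum_apply, inc, Finset.sum_smul]
    refine Finset.sum_congr rfl fun v _ => ?_
    rw [LinearMap.smul_apply, Finsupp.smul_apply, Finsupp.lsingle_apply, Finsupp.single_apply]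
    split_ifs <;> simp
  · intro τ _ hτ
    rw [Finsupp.notMem_support_iff.1 hτ, map_zero]

omit [LinearOrder V] in
lemma mem_chains {c : Finset V →₀ G} :
    c ∈ chains A G K i ↔ ∀ σ, c σ ≠ 0 → σ ∈ K ∧ (#σ : ℤ) = i + 1 := by
  rw [chains, Finsupp.mem_supported]
  simp [Set.subset_def]

/-- `X` is the set of simplices of the complex `K` outside of the subcomplex `L`. -/
structure IsDiff (K L : Set (Finset V)) (X : Finset (Finset V)) : Prop where
  lower : IsLowerSet K
  lower' : IsLowerSet L
  mem_iff : ∀ ρ, ρ ∈ X ↔ ρ ∈ K ∧ ρ ∉ L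

lemma IsDiff.bdry_eq (H : IsDiff K L X) {c : Finset V →₀ G}
    (hc : c ∈ chains A G K i) {ρ : Finset V} (hρ : ρ ∈ X) :
    bdry A G c ρ = ∑ τ ∈ X, inc τ ρ • c τ := by
  classical
  rw [bdry_apply c (Finset.subset_union_left (s₂ := X)) ρ]
  refine (Finset.sum_subset Finset.subset_union_right fun τ hτ hτX => ?_).symm
  by_contra hne
  have h1 : inc τ ρ ≠ 0 := fun h => hne (by rw [h, zero_smul])
  have h2 : c τ ≠ 0 := fun h => hne (by rw [h, smul_zero])
  refine hτX ((H.mem_iff τ).2 ⟨(mem_chains.1 hc τ h2).1, fun hL => ?_⟩)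
  exact ((H.mem_iff ρ).1 hρ).2 (H.lower' (subset_of_inc_ne_zero h1) hL)

lemma IsDiff.exists_of_bdry_ne_zero (H : IsDiff K L X) {c : Finset V →₀ G}
    (hc : c ∈ chains A G K i) {ρ : Finset V} (hρ : bdry A G c ρ ≠ 0) :
    ρ ∈ K ∧ (#ρ : ℤ) = i := by
  rw [bdry_apply c subset_rfl ρ] at hρ
  obtain ⟨τ, -, hne⟩ := Finset.exists_ne_zero_of_sum_ne_zero hρ
  have h1 : inc τ ρ ≠ 0 := fun h => hne (by rw [h, zero_smul])
  have h2 : c τ ≠ 0 := fun h => hne (by rw [h, smul_zero])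
  obtain ⟨h3, h4⟩ := mem_chains.1 hc τ h2
  refine ⟨H.lower (subset_of_inc_ne_zero h1) h3, ?_⟩
  rw [card_of_inc_ne_zero h1] at h4
  push_cast at h4
  linarith

lemma IsDiff.mem_relCycles (H : IsDiff K L X) {c : Finset V →₀ G} :
    c ∈ relCycles A G K L i ↔ c ∈ chains A G K i ∧
      ∀ ρ ∈ X, (#ρ : ℤ) = i → ∑ τ ∈ X, inc τ ρ • c τ = 0 := by
  rw [relCycles, Submodule.mem_inf, Submodule.mem_comap, mem_chains (K := L)]
  refine and_congr_right fun hc => ⟨fun h ρ hρ _ => ?_, fun h ρ hρ => ?_⟩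
  · rw [← H.bdry_eq hc hρ]
    by_contra hne
    exact ((H.mem_iff ρ).1 hρ).2 (h ρ hne).1
  · obtain ⟨h1, h2⟩ := H.exists_of_bdry_ne_zero hc hρ
    refine ⟨?_, by linarith⟩
    by_contra hL
    have hX := (H.mem_iff ρ).2 ⟨h1, hL⟩
    exact hρ ((H.bdry_eq hc hX).trans (h ρ hX h2))

/-- The `i`-chain with the coefficients `x` on the `i`-simplices of `X`. -/
def restrictChain (X : Finset (Finset V)) (i : ℤ) (x : Finset V → G) : Finset V →₀ G :=
  Finsupp.onFinset X (fun ρ => if ρ ∈ X ∧ (#ρ : ℤ) = i + 1 then x ρ else 0) fun ρ h => by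
    by_contra hρ; exact h (if_neg fun h' => hρ h'.1)

lemma restrictChain_apply {x : Finset V → G} {ρ : Finset V} (h : ρ ∈ X) (h' : (#ρ : ℤ) = i + 1) :
    restrictChain X i x ρ = x ρ := if_pos ⟨h, h'⟩

lemma IsDiff.restrictChain_mem (H : IsDiff K L X) (x : Finset V → G) :
    restrictChain X i x ∈ chains A G K i := by
  refine mem_chains.2 fun σ hσ => ?_
  have : σ ∈ X ∧ (#σ : ℤ) = i + 1 := by by_contra h; exact hσ (if_neg h)
  exact ⟨((H.mem_iff σ).1 this.1).1, this.2⟩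

lemma sum_restrictChain (x : Finset V → G) {ρ : Finset V} (h : (#ρ : ℤ) = i) :
    ∑ τ ∈ X, inc τ ρ • restrictChain X i x τ = ∑ τ ∈ X, inc τ ρ • x τ := by
  refine Finset.sum_congr rfl fun τ hτ => ?_
  by_cases h0 : inc τ ρ = 0
  · rw [h0, zero_smul, zero_smul]
  · rw [restrictChain_apply hτ (by rw [card_of_inc_ne_zero h0]; push_cast; rw [h])]

lemma IsDiff.mem_relBoundaries (H : IsDiff K L X) {c : Finset V →₀ G}
    (hc : c ∈ chains A G K i) :
    c ∈ relBoundaries A G K L i ↔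
      ∃ y : Finset V → G, ∀ ρ ∈ X, (#ρ : ℤ) = i + 1 → c ρ = ∑ τ ∈ X, inc τ ρ • y τ := by
  rw [relBoundaries, Submodule.mem_sup]
  constructor
  · rintro ⟨_, ⟨b, hb, rfl⟩, l, hl, rfl⟩
    refine ⟨b, fun ρ hρ _ => ?_⟩
    rw [← H.bdry_eq hb hρ, Finsupp.add_apply, add_eq_left]
    by_contra hne
    exact ((H.mem_iff ρ).1 hρ).2 (mem_chains.1 hl ρ hne).1
  · rintro ⟨y, hy⟩
    have hb : restrictChain X (i + 1) y ∈ chains A G K (i + 1) := H.restrictChain_mem y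
    refine ⟨_, ⟨_, hb, rfl⟩, c - bdry A G (restrictChain X (i + 1) y), ?_, add_sub_cancel _ _⟩
    refine mem_chains.2 fun ρ hρ => ?_
    have hK : ρ ∈ K ∧ (#ρ : ℤ) = i + 1 := by
      by_cases h : c ρ = 0
      · rw [Finsupp.sub_apply, h, zero_sub, neg_ne_zero] at hρ
        exact H.exists_of_bdry_ne_zero hb hρ
      · exact mem_chains.1 hc ρ h
    refine ⟨?_, hK.2⟩
    by_contra hL
    have hX := (H.mem_iff ρ).2 ⟨hK.1, hL⟩
    apply hρ
    rw [Finsupp.sub_apply, H.bdry_eq hb hX, sum_restrictChain y hK.2, hy ρ hX hK.2, sub_self]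

lemma subsingleton_homology_iff :
    Subsingleton (Homology A G K L i) ↔ relCycles A G K L i ≤ relBoundaries A G K L i := by
  rw [Submodule.Quotient.subsingleton_iff, Submodule.submoduleOf,
    Submodule.comap_subtype_eq_top]

/-- Exactness, at the simplices with `k` vertices, of the chain complex spanned by `X`. -/
def IsExactAt (G : Type*) [AddCommGroup G] (X : Finset (Finset V)) (k : ℤ) : Prop :=
  ∀ x : Finset V → G, (∀ ρ ∈ X, (#ρ : ℤ) + 1 = k → ∑ τ ∈ X, inc τ ρ • x τ = 0) →
    ∃ y : Finset V → G, ∀ ρ ∈ X, (#ρ : ℤ) = k → x ρ = ∑ τ ∈ X, inc τ ρ • y τ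

lemma IsDiff.subsingleton_iff (H : IsDiff K L X) :
    Subsingleton (Homology A G K L i) ↔ IsExactAt G X (i + 1) := by
  rw [subsingleton_homology_iff]
  constructor
  · intro h x hx
    have hc : restrictChain X i x ∈ relCycles A G K L i := by
      refine H.mem_relCycles.2 ⟨H.restrictChain_mem x, fun ρ hρ hi => ?_⟩
      rw [sum_restrictChain x hi, hx ρ hρ (by linarith)]
    obtain ⟨y, hy⟩ := (H.mem_relBoundaries (H.restrictChain_mem x)).1 (h hc)
    exact ⟨y, fun ρ hρ hi => by rw [← hy ρ hρ hi, restrictChain_apply hρ hi]⟩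
  · intro h c hc
    obtain ⟨h1, h2⟩ := H.mem_relCycles.1 hc
    exact (H.mem_relBoundaries h1).2 (h c fun ρ hρ hi => h2 ρ hρ (by linarith))

/-- Top homology, if the top cycles are determined by their values on a set `S` of simplices and
these can be prescribed arbitrarily. -/
lemma IsDiff.nonempty_equiv (H : IsDiff K L X) (S : Finset (Finset V))
    (hSX : ∀ ρ ∈ S, ρ ∈ X ∧ (#ρ : ℤ) = i + 1)
    (htop : ∀ ρ ∈ X, (#ρ : ℤ) ≠ i + 2)
    (hinj : ∀ x : Finset V → G,
      (∀ ρ ∈ X, (#ρ : ℤ) = i → ∑ τ ∈ X, inc τ ρ • x τ = 0) →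
      (∀ ρ ∈ S, x ρ = 0) → ∀ ρ ∈ X, (#ρ : ℤ) = i + 1 → x ρ = 0)
    (hsurj : ∀ f : S → G, ∃ x : Finset V → G,
      (∀ ρ ∈ X, (#ρ : ℤ) = i → ∑ τ ∈ X, inc τ ρ • x τ = 0) ∧ ∀ ρ : S, x ρ = f ρ) :
    Nonempty (Homology A G K L i ≃ₗ[A] (S → G)) := by
  set Φ : relCycles A G K L i →ₗ[A] (S → G) :=
    LinearMap.pi fun ρ => Finsupp.lapply (ρ : Finset V) ∘ₗ (relCycles A G K L i).subtype
  have hΦ : ∀ c ρ, Φ c ρ = (c : Finset V →₀ G) ρ := fun c ρ => rfl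
  have hker : (relBoundaries A G K L i).submoduleOf (relCycles A G K L i) = LinearMap.ker Φ := by
    ext c
    obtain ⟨h1, h2⟩ := H.mem_relCycles.1 c.2
    rw [Submodule.submoduleOf, Submodule.mem_comap, Submodule.subtype_apply,
      H.mem_relBoundaries h1, LinearMap.mem_ker]
    have hz : ∀ (y : Finset V → G), ∀ ρ ∈ X, (#ρ : ℤ) = i + 1 →
        ∑ τ ∈ X, inc τ ρ • y τ = 0 := by
      intro y ρ _ hρ
      refine Finset.sum_eq_zero fun τ hτ => ?_
      by_cases h0 : inc τ ρ = 0
      · rw [h0, zero_smul]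
      · refine absurd ?_ (htop τ hτ)
        rw [card_of_inc_ne_zero h0]; push_cast; linarith
    constructor
    · rintro ⟨y, hy⟩
      ext ρ
      obtain ⟨h3, h4⟩ := hSX ρ ρ.2
      rw [hΦ, hy ρ h3 h4, hz y ρ h3 h4]; rfl
    · intro h
      refine ⟨0, fun ρ hρ hi => ?_⟩
      rw [hz 0 ρ hρ hi]
      exact hinj _ h2 (fun ρ hρ => congrFun h ⟨ρ, hρ⟩) ρ hρ hi
  have hsur : Function.Surjective Φ := by
    intro f
    obtain ⟨x, hx, hxf⟩ := hsurj f
    have hc : restrictChain X i x ∈ relCycles A G K L i := by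
      refine H.mem_relCycles.2 ⟨H.restrictChain_mem x, fun ρ hρ hi => ?_⟩
      rw [sum_restrictChain x hi, hx ρ hρ hi]
    refine ⟨⟨_, hc⟩, ?_⟩
    ext ρ
    obtain ⟨h3, h4⟩ := hSX ρ ρ.2
    rw [hΦ, ← hxf ρ]
    exact restrictChain_apply h3 h4
  exact ⟨(Submodule.quotEquivOfEq _ _ hker).trans (Φ.quotKerEquivOfSurjective hsur)⟩

lemma IsExactAt.isExact {R : Type*} [CommRing R] [Module R G]
    (h : ∀ k : ℕ, IsExactAt G X k) : IsExact G (incMat R) X := by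
  have hd : ∀ (x : Finset V → G) ρ, dif (incMat R) X x ρ = ∑ τ ∈ X, inc τ ρ • x τ := fun x ρ =>
    Finset.sum_congr rfl fun τ _ => Int.cast_smul_eq_zsmul R _ _
  intro x hx
  have := fun k : ℕ => h k x fun ρ hρ _ => by rw [← hd]; exact hx ρ hρ
  choose y hy using this
  refine ⟨fun τ => y (#τ - 1) τ, fun ρ hρ => ?_⟩
  rw [hd, hy #ρ ρ hρ rfl]
  refine Finset.sum_congr rfl fun τ _ => ?_
  by_cases h0 : inc τ ρ = 0
  · rw [h0, zero_smul, zero_smul]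
  · rw [card_of_inc_ne_zero h0, Nat.add_sub_cancel]

end RelativeHomology

/-! ### Connectivity and top cycles of Cohen–Macaulay complexes -/

section CohenMacaulay

variable {V G : Type*} [LinearOrder V] [AddCommGroup G]

variable (G) in
/-- `K` is a finite complex of dimension at most `N` whose local homology with coefficients in `G`
is concentrated in degree `N`, the degree of the simplices with `N + 1` vertices. -/
structure IsFiniteCM (K : Finset (Finset V)) (N : ℕ) : Prop where
  lower : ∀ τ ∈ K, ∀ ρ ⊆ τ, ρ ∈ K
  card_le : ∀ τ ∈ K, #τ ≤ N + 1
  exact : ∀ σ ∈ K, ∀ k : ℤ, k ≠ N + 1 → IsExactAt G (star K σ) k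

/-- The simplices with `N + 1` vertices that contain `τ`. -/
def facetsOver (K : Finset (Finset V)) (N : ℕ) (τ : Finset V) : Finset (Finset V) :=
  {F ∈ K | τ ⊆ F ∧ #F = N + 1}

variable {K : Finset (Finset V)} {N : ℕ}

lemma mem_facetsOver {τ F : Finset V} :
    F ∈ facetsOver K N τ ↔ F ∈ K ∧ τ ⊆ F ∧ #F = N + 1 := Finset.mem_filter

lemma inc_mul_self {τ ρ : Finset V} (h : ρ ⊆ τ) (hc : #τ = #ρ + 1) : inc τ ρ * inc τ ρ = 1 := by
  rcases inc_eq_one_or h hc with h | h <;> simp [h]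

lemma inc_smul_eq_zero {τ ρ : Finset V} (h : ρ ⊆ τ) (hc : #τ = #ρ + 1) {g : G}
    (hg : inc τ ρ • g = 0) : g = 0 := by
  rcases inc_eq_one_or h hc with h | h <;> simpa [h] using hg

lemma IsFiniteCM.exists_facet [Nontrivial G] (H : IsFiniteCM G K N) {σ : Finset V} (hσ : σ ∈ K) :
    ∃ F, F ∈ facetsOver K N σ := by
  obtain ⟨τ, hστ, hτ⟩ := K.exists_le_maximal hσ
  refine ⟨τ, mem_facetsOver.2 ⟨hτ.prop, hστ, ?_⟩⟩
  by_contra hne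
  have hstar : star K τ = {τ} := by
    ext ρ
    rw [mem_star, Finset.mem_singleton]
    exact ⟨fun h => (hτ.eq_of_le h.1 h.2).symm, by rintro rfl; exact ⟨hτ.prop, subset_rfl⟩⟩
  obtain ⟨g, hg⟩ := exists_ne (0 : G)
  obtain ⟨y, hy⟩ := H.exact τ hτ.prop #τ (by exact_mod_cast hne) (fun _ => g) (by
    rw [hstar]; simp)
  rw [hstar] at hy
  have := hy τ (by simp) rfl
  rw [Finset.sum_singleton, inc_self, zero_smul] at this
  exact hg this

/-- Exactness just above `ρ` means that the link of `ρ` is connected: a property of the vertices of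
the link that is passed on along its edges holds for all of them or for none. -/
lemma IsExactAt.connected [Nontrivial G] {X : Finset (Finset V)} {ρ : Finset V}
    (hX : IsExactAt G X (#ρ + 1)) (hρ : ∀ ρ' ∈ X, #ρ' = #ρ → ρ' = ρ)
    (hconv : ∀ μ ∈ X, ∀ τ, ρ ⊆ τ → τ ⊆ μ → τ ∈ X) (p : Finset V → Prop)
    (hp : ∀ μ ∈ X, ∀ τ ∈ X, ∀ τ' ∈ X, inc μ τ * inc τ ρ ≠ 0 → inc μ τ' * inc τ' ρ ≠ 0 →
      p τ → p τ')
    {a c : Finset V} (ha : a ∈ X) (hc : c ∈ X) (haρ : inc a ρ ≠ 0) (hcρ : inc c ρ ≠ 0)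
    (h : p a) : p c := by
  classical
  by_contra hn
  have sq : ∀ {τ}, inc τ ρ ≠ 0 → inc τ ρ * inc τ ρ = 1 := fun h =>
    inc_mul_self (subset_of_inc_ne_zero h) (card_of_inc_ne_zero h)
  have hac : a ≠ c := fun h' => hn (h' ▸ h)
  obtain ⟨g, hg⟩ := exists_ne (0 : G)
  set x : Finset V → G := fun τ => if τ = a then inc a ρ • g else
    if τ = c then - (inc c ρ • g) else 0
  obtain ⟨y, hy⟩ := hX x (by
    intro ρ' hρ' hc'
    obtain rfl := hρ ρ' hρ' (by exact_mod_cast add_right_cancel hc')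
    rw [← Finset.sum_subset (s₁ := {a, c}), Finset.sum_pair hac]
    · simp only [x, if_true, if_neg hac.symm, smul_neg, smul_smul, sq haρ, sq hcρ]
      simp
    · intro τ hτ
      rcases Finset.mem_insert.1 hτ with rfl | hτ
      · exact ha
      · rw [Finset.mem_singleton.1 hτ]; exact hc
    · intro τ _ hτ
      simp only [Finset.mem_insert, Finset.mem_singleton, not_or] at hτ
      simp [x, hτ.1, hτ.2])
  set S : Finset (Finset V) := {τ ∈ X | #τ = #ρ + 1 ∧ p τ}
  have e1 : ∑ τ ∈ S, inc τ ρ • x τ = g := by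
    rw [Finset.sum_eq_single a]
    · simp only [x, if_true, smul_smul, sq haρ, one_smul]
    · intro τ hτ hτa
      have : τ ≠ c := by rintro rfl; exact hn (Finset.mem_filter.1 hτ).2.2
      simp [x, hτa, this]
    · exact fun h' => absurd (Finset.mem_filter.2 ⟨ha, card_of_inc_ne_zero haρ, h⟩) h'
  have e2 : ∑ τ ∈ S, inc τ ρ • x τ = 0 := by
    have : ∀ τ ∈ S, inc τ ρ • x τ = ∑ μ ∈ X, (inc μ τ * inc τ ρ) • y μ := by
      intro τ hτ
      obtain ⟨h3, h4, -⟩ := Finset.mem_filter.1 hτ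
      rw [hy τ h3 (by exact_mod_cast h4), Finset.smul_sum]
      exact Finset.sum_congr rfl fun μ _ => by rw [smul_smul, mul_comm]
    rw [Finset.sum_congr rfl this, Finset.sum_comm]
    refine Finset.sum_eq_zero fun μ hμ => ?_
    rw [← Finset.sum_smul]
    convert zero_smul ℤ (y μ)
    -- either all faces of `μ` over `ρ` satisfy `p`, or none
    by_cases hex : ∃ τ ∈ S, inc μ τ * inc τ ρ ≠ 0
    · obtain ⟨τ, hτ, hne⟩ := hex
      obtain ⟨h3, -, h4⟩ := Finset.mem_filter.1 hτ
      rw [← inc_sq (X := X) (τ := μ) (π := ρ) fun τ h3 h4 => hconv μ hμ τ h3 h4]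
      refine Finset.sum_subset (Finset.filter_subset _ _) fun τ' hτ' hτS => ?_
      by_contra hne'
      exact hτS (Finset.mem_filter.2 ⟨hτ', card_of_inc_ne_zero (right_ne_zero_of_mul hne'),
        hp μ hμ τ h3 τ' hτ' hne hne' h4⟩)
    · push Not at hex
      exact Finset.sum_eq_zero hex
  exact hg (e1.symm.trans e2)

/-- Strong connectivity of stars: a property that passes between facets sharing a ridge over `ρ`
holds for all facets over `ρ` or for none. -/
lemma IsFiniteCM.facet_induction [Nontrivial G] (H : IsFiniteCM G K N) {ρ : Finset V}
    (hρ : ρ ∈ K) (p : Finset V → Prop)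
    (hp : ∀ τ ∈ K, ρ ⊆ τ → #τ = N → ∀ F ∈ facetsOver K N τ, ∀ F' ∈ facetsOver K N τ, p F → p F')
    {F F' : Finset V} (hF : F ∈ facetsOver K N ρ) (hF' : F' ∈ facetsOver K N ρ) (h : p F) :
    p F' := by
  induction hm : N + 1 - #ρ using Nat.strong_induction_on generalizing ρ F F' with
  | _ m ih =>
  obtain ⟨hFK, hρF, hFc⟩ := mem_facetsOver.1 hF
  obtain ⟨hFK', hρF', hFc'⟩ := mem_facetsOver.1 hF'
  have hle := H.card_le ρ hρ
  by_cases h1 : #ρ = N + 1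
  · have e1 := Finset.eq_of_subset_of_card_le hρF (by omega)
    have e2 := Finset.eq_of_subset_of_card_le hρF' (by omega)
    rwa [← e2, e1]
  by_cases h2 : #ρ = N
  · exact hp ρ hρ subset_rfl h2 F hF F' hF' h
  have step : ∀ τ, τ ∈ star K ρ → #τ = #ρ + 1 → ∀ F ∈ facetsOver K N τ,
      ∀ F' ∈ facetsOver K N τ, p F → p F' := by
    intro τ hτ hτc F hF F' hF' hpF
    exact ih (N + 1 - #τ) (by omega) (mem_star.1 hτ).1
      (fun τ' h1 h2 => hp τ' h1 ((mem_star.1 hτ).2.trans h2)) hF hF' hpF rfl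
  have hex : ∀ F, F ∈ K → ρ ⊆ F → #F = N + 1 → ∃ a, a ∈ star K ρ ∧ inc a ρ ≠ 0 ∧ a ⊆ F := by
    intro F hFK hρF hFc
    obtain ⟨a, h3, h4, h5⟩ := Finset.exists_subsuperset_card_eq hρF (Nat.le_succ #ρ) (by omega)
    exact ⟨a, mem_star.2 ⟨H.lower F hFK a h4, h3⟩,
      left_ne_zero_of_mul ((inc_mul_self h3 h5).trans_ne one_ne_zero), h4⟩
  obtain ⟨a, haK, haρ, haF⟩ := hex F hFK hρF hFc
  obtain ⟨c, hcK, hcρ, hcF⟩ := hex F' hFK' hρF' hFc'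
  refine IsExactAt.connected (G := G) (X := star K ρ) (ρ := ρ) (a := a) (c := c)
    (p := fun τ => ∀ F ∈ facetsOver K N τ, p F) ?_ ?_ ?_ ?_ haK hcK haρ hcρ ?_ F'
    (mem_facetsOver.2 ⟨hFK', hcF, hFc'⟩)
  · exact H.exact ρ hρ (#ρ + 1) fun h => h2 (by exact_mod_cast add_right_cancel h)
  · exact fun ρ' h3 h4 => (Finset.eq_of_subset_of_card_le (mem_star.1 h3).2 h4.le).symm
  · exact fun μ h3 τ h4 h5 => mem_star.2 ⟨H.lower μ (mem_star.1 h3).1 τ h5, h4⟩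
  · intro μ hμ τ _ τ' hτ' hne hne' hpτ F₂ hF₂
    obtain ⟨F₁, hF₁⟩ := H.exists_facet (mem_star.1 hμ).1
    obtain ⟨hF₁K, hμF₁, hF₁c⟩ := mem_facetsOver.1 hF₁
    exact step τ' hτ' (card_of_inc_ne_zero (right_ne_zero_of_mul hne')) F₁
      (mem_facetsOver.2 ⟨hF₁K, (subset_of_inc_ne_zero (left_ne_zero_of_mul hne')).trans hμF₁,
        hF₁c⟩) F₂ hF₂ (hpτ F₁ (mem_facetsOver.2
          ⟨hF₁K, (subset_of_inc_ne_zero (left_ne_zero_of_mul hne)).trans hμF₁, hF₁c⟩))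
  · exact fun F₁ hF₁ => step a haK (card_of_inc_ne_zero haρ) F
      (mem_facetsOver.2 ⟨hFK, haF, hFc⟩) F₁ hF₁ h

/-- The faces of the ridges that lie in exactly one facet. -/
def ridgeBd (K : Finset (Finset V)) (N : ℕ) : Finset (Finset V) :=
  {σ ∈ K | ∃ τ ∈ K, σ ⊆ τ ∧ #τ = N ∧ #(facetsOver K N τ) = 1}

lemma mem_ridgeBd {σ : Finset V} : σ ∈ ridgeBd K N ↔
    σ ∈ K ∧ ∃ τ ∈ K, σ ⊆ τ ∧ #τ = N ∧ #(facetsOver K N τ) = 1 := Finset.mem_filter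

lemma sum_star_eq {M : Type*} [AddCommMonoid M] {σ τ : Finset V} (hσ : σ ⊆ τ) (hτ : #τ = N)
    (f : Finset V → M)
    (hf : ∀ ρ, inc ρ τ = 0 → f ρ = 0) :
    ∑ ρ ∈ star K σ, f ρ = ∑ ρ ∈ facetsOver K N τ, f ρ := by
  refine (Finset.sum_subset (fun F hF => ?_) fun ρ hρ hn => ?_).symm
  · rw [mem_facetsOver] at hF
    exact mem_star.2 ⟨hF.1, hσ.trans hF.2.1⟩
  · refine hf ρ ?_
    by_contra h
    exact hn (mem_facetsOver.2 ⟨(mem_star.1 hρ).1, subset_of_inc_ne_zero h,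
      by rw [card_of_inc_ne_zero h, hτ]⟩)

lemma sum_smul_star_eq {σ τ : Finset V} (hσ : σ ⊆ τ) (hτ : #τ = N) (x : Finset V → G) :
    ∑ ρ ∈ star K σ, inc ρ τ • x ρ = ∑ ρ ∈ facetsOver K N τ, inc ρ τ • x ρ :=
  sum_star_eq hσ hτ _ fun ρ h => by rw [h, zero_smul]

lemma star_empty : star K ∅ = K := by
  ext; simp [mem_star]

lemma facetsOver_eq_pair {τ F F' : Finset V} (h2 : #(facetsOver K N τ) ≤ 2)
    (hF : F ∈ facetsOver K N τ) (hF' : F' ∈ facetsOver K N τ) (hne : F ≠ F') :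
    facetsOver K N τ = {F, F'} := by
  refine (Finset.eq_of_subset_of_card_le ?_ (by rw [Finset.card_pair hne]; exact h2)).symm
  intro x hx
  rcases Finset.mem_insert.1 hx with rfl | hx
  · exact hF
  · rw [Finset.mem_singleton.1 hx]; exact hF'

variable [Nontrivial G]

lemma IsFiniteCM.isExactAt_of_mem_ridgeBd (H : IsFiniteCM G K N)
    (h2 : ∀ τ ∈ K, #τ = N → #(facetsOver K N τ) ≤ 2) {σ : Finset V} (hσ : σ ∈ ridgeBd K N) :
    IsExactAt G (star K σ) (N + 1) := by
  obtain ⟨hσK, τ, hτK, hστ, hτ, hτ1⟩ := mem_ridgeBd.1 hσ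
  obtain ⟨F₀, hF₀⟩ := Finset.card_eq_one.1 hτ1
  have hF₀' : F₀ ∈ facetsOver K N τ := by simp [hF₀]
  obtain ⟨hF₀K, hτF₀, hF₀c⟩ := mem_facetsOver.1 hF₀'
  intro x hx
  have hx' : ∀ ρ ∈ K, σ ⊆ ρ → #ρ = N → ∑ F ∈ facetsOver K N ρ, inc F ρ • x F = 0 := by
    intro ρ hρ hσρ hc
    rw [← sum_smul_star_eq hσρ hc]
    exact hx ρ (mem_star.2 ⟨hρ, hσρ⟩) (by rw [hc])
  have h0 : x F₀ = 0 := by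
    have := hx' τ hτK hστ hτ
    rw [hF₀, Finset.sum_singleton] at this
    exact inc_smul_eq_zero hτF₀ (by omega) this
  refine ⟨0, fun F hF hc => ?_⟩
  have hzero : x F = 0 := by
    refine H.facet_induction hσK (fun F => x F = 0) ?_
      (mem_facetsOver.2 ⟨hF₀K, hστ.trans hτF₀, hF₀c⟩)
      (mem_facetsOver.2 ⟨(mem_star.1 hF).1, (mem_star.1 hF).2, by exact_mod_cast hc⟩) h0
    intro ρ hρ hσρ hρc F hF F' hF' hxF
    by_cases hne : F = F'
    · exact hne ▸ hxF
    have := hx' ρ hρ hσρ hρc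
    rw [facetsOver_eq_pair (h2 ρ hρ hρc) hF hF' hne, Finset.sum_pair hne, hxF, smul_zero,
      zero_add] at this
    exact inc_smul_eq_zero (mem_facetsOver.1 hF').2.1 (by rw [(mem_facetsOver.1 hF').2.2, hρc]) this
  rw [hzero]
  simp

variable {R : Type*} [CommRing R] [Module R G]

/-- Signs of the facets for which the sum of all facets is a cycle at every ridge that does not lie
in exactly one facet. -/
structure IsOrientation (K : Finset (Finset V)) (N : ℕ) (e : Finset V → R) : Prop where
  eq_zero : ∀ F, ¬ (F ∈ K ∧ #F = N + 1) → e F = 0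
  eq_one_or : ∀ F ∈ K, #F = N + 1 → e F = 1 ∨ e F = -1
  cycle : ∀ τ ∈ K, #τ = N → #(facetsOver K N τ) ≠ 1 →
    ∑ F ∈ facetsOver K N τ, incMat R τ F * e F = 0

omit [Nontrivial G] [Module R G] in
lemma IsOrientation.isFundamental {e : Finset V → R} (he : IsOrientation K N e)
    (H : IsFiniteCM G K N) :
    IsFundamental K (ridgeBd K N) N e where
  lower := H.lower
  bd_subset := Finset.filter_subset _ _
  bd_lower τ hτ ρ hρ := by
    obtain ⟨h1, π, h2, h3, h4⟩ := mem_ridgeBd.1 hτ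
    exact mem_ridgeBd.2 ⟨H.lower τ h1 ρ hρ, π, h2, hρ.trans h3, h4⟩
  supp ρ hρ := by by_contra h; exact hρ (he.eq_zero ρ h)
  cycle τ hτ hτB := by
    by_cases hc : #τ = N
    · have := sum_star_eq (K := K) (Finset.empty_subset τ) hc (fun ρ => incMat R τ ρ * e ρ)
        fun ρ h => by simp [incMat, h]
      rw [star_empty] at this
      rw [this]
      exact he.cycle τ hτ hc fun h => hτB (mem_ridgeBd.2 ⟨hτ, τ, hτ, subset_rfl, hc, h⟩)
    · refine Finset.sum_eq_zero fun ρ _ => ?_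
      by_contra hne
      have h1 := card_of_inc_ne_zero (inc_ne_zero_of_incMat (left_ne_zero_of_mul hne))
      have h2 : #ρ = N + 1 := by
        by_contra h; exact right_ne_zero_of_mul hne (he.eq_zero ρ fun h' => h h'.2)
      omega

/-- Around a simplex outside of the boundary all top cycles are multiples of the fundamental class.
-/
lemma IsFiniteCM.eq_smul_of_cycle (H : IsFiniteCM G K N)
    (h2 : ∀ τ ∈ K, #τ = N → #(facetsOver K N τ) ≤ 2) {e : Finset V → R}
    (he : IsOrientation K N e) {σ : Finset V} (hσ : σ ∈ K) (hσB : σ ∉ ridgeBd K N)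
    {x : Finset V → G}
    (hx : ∀ ρ ∈ star K σ, #ρ = N → ∑ τ ∈ star K σ, inc τ ρ • x τ = 0) :
    ∃ g : G, ∀ F ∈ facetsOver K N σ, x F = e F • g := by
  obtain ⟨F₀, hF₀⟩ := H.exists_facet hσ
  have sq : ∀ F, F ∈ K → #F = N + 1 → e F * e F = 1 := fun F h h' => by
    rcases he.eq_one_or F h h' with h | h <;> simp [h]
  refine ⟨e F₀ • x F₀, fun F hF => ?_⟩
  refine H.facet_induction hσ (fun F => x F = e F • e F₀ • x F₀) ?_ hF₀ hF ?_
  · intro ρ hρ hσρ hc F hF F' hF' hxF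
    by_cases hne : F = F'
    · exact hne ▸ hxF
    have hpair := facetsOver_eq_pair (h2 ρ hρ hc) hF hF' hne
    have h1 := hx ρ (mem_star.2 ⟨hρ, hσρ⟩) hc
    rw [sum_smul_star_eq hσρ hc, hpair, Finset.sum_pair hne, hxF] at h1
    have h3 := he.cycle ρ hρ hc fun h => hσB (mem_ridgeBd.2 ⟨hσ, ρ, hρ, hσρ, hc, h⟩)
    rw [hpair, Finset.sum_pair hne] at h3
    refine sub_eq_zero.1 (inc_smul_eq_zero (mem_facetsOver.1 hF').2.1
      (by rw [(mem_facetsOver.1 hF').2.2, hc]) ?_)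
    rw [smul_sub, eq_neg_of_add_eq_zero_right h1, ← Int.cast_smul_eq_zsmul R (inc F ρ),
      ← Int.cast_smul_eq_zsmul R (inc F' ρ), smul_smul, smul_smul _ (e F'), ← neg_add',
      ← add_smul]
    simp only [incMat] at h3
    rw [h3, zero_smul, neg_zero]
  · obtain ⟨h3, -, h4⟩ := mem_facetsOver.1 hF₀
    rw [smul_smul, sq F₀ h3 h4, one_smul]

lemma IsFiniteCM.isExact_augInc (H : IsFiniteCM G K N)
    (h2 : ∀ τ ∈ K, #τ = N → #(facetsOver K N τ) ≤ 2) {e : Finset V → R}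
    (he : IsOrientation K N e) {σ : Finset V} (hσ : σ ∈ K) (hσB : σ ∉ ridgeBd K N) :
    IsExact G (augInc e) (Finset.insertNone (star K σ)) := by
  intro x hx
  have hd : ∀ (x : Option (Finset V) → G) ρ,
      dif (augInc e) (Finset.insertNone (star K σ)) x (some ρ) =
        e ρ • x none + ∑ τ ∈ star K σ, inc τ ρ • x (some τ) := fun x ρ => by
    rw [dif, Finset.sum_insertNone]
    congr 1
    exact Finset.sum_congr rfl fun τ _ => Int.cast_smul_eq_zsmul R _ _
  have hd0 : ∀ x : Option (Finset V) → G,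
      dif (augInc e) (Finset.insertNone (star K σ)) x none = 0 := fun x => by
    simp [dif, augInc]
  have hz : ∀ ρ ∈ star K σ, e ρ • x none + ∑ τ ∈ star K σ, inc τ ρ • x (some τ) = 0 := by
    intro ρ hρ
    rw [← hd]
    exact hx _ (Finset.some_mem_insertNone.2 hρ)
  have htop : ∀ F ∈ facetsOver K N σ, ∀ y : Finset V → G,
      ∑ τ ∈ star K σ, inc τ F • y τ = 0 := by
    intro F hF y
    refine Finset.sum_eq_zero fun τ hτ => ?_
    by_cases h : inc τ F = 0
    · rw [h, zero_smul]
    · have h1 := card_of_inc_ne_zero h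
      have h3 := H.card_le τ (mem_star.1 hτ).1
      have h4 := (mem_facetsOver.1 hF).2.2
      omega
  -- at a facet the cycle condition only sees the extra generator
  have hnone : x none = 0 := by
    obtain ⟨F, hF⟩ := H.exists_facet hσ
    obtain ⟨h3, h4, h5⟩ := mem_facetsOver.1 hF
    have := hz F (mem_star.2 ⟨h3, h4⟩)
    rw [htop F hF (fun τ => x (some τ)), add_zero] at this
    rcases he.eq_one_or F h3 h5 with h | h <;> simpa [h] using this
  simp only [hnone, smul_zero, zero_add] at hz
  obtain ⟨g, hg⟩ := H.eq_smul_of_cycle h2 he hσ hσB (x := fun τ => x (some τ))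
    (fun ρ hρ _ => hz ρ hρ)
  have := fun k : ℕ => fun hk : k ≠ N + 1 => H.exact σ hσ k (by exact_mod_cast hk)
    (fun τ => x (some τ)) fun ρ hρ _ => hz ρ hρ
  choose! y hy using this
  refine ⟨fun t => t.elim g fun τ => y (#τ - 1) τ, ?_⟩
  rintro (_ | ρ) hρ
  · rw [hnone, hd0]
  · rw [Finset.some_mem_insertNone] at hρ
    rw [hd]
    simp only [Option.elim]
    by_cases hc : #ρ = N + 1
    · have hF : ρ ∈ facetsOver K N σ := mem_facetsOver.2 ⟨(mem_star.1 hρ).1, (mem_star.1 hρ).2, hc⟩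
      rw [htop ρ hF (fun τ => y (#τ - 1) τ), add_zero]
      exact hg ρ hF
    · rw [he.eq_zero ρ fun h => hc h.2, zero_smul, zero_add, hy #ρ hc ρ hρ rfl]
      refine Finset.sum_congr rfl fun τ _ => ?_
      by_cases h : inc τ ρ = 0
      · rw [h, zero_smul, zero_smul]
      · have h1 := card_of_inc_ne_zero h
        rw [h1, Nat.add_sub_cancel]

end CohenMacaulay

/-! ### Orientations and the boundary sphere -/

section Orientation

variable {V G : Type*} [LinearOrder V] [AddCommGroup G] [Nontrivial G]
variable {K : Finset (Finset V)} {N : ℕ}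

lemma IsFiniteCM.exists_pair (H : IsFiniteCM G K N)
    (h2 : ∀ τ ∈ K, #τ = N → #(facetsOver K N τ) ≤ 2) {τ : Finset V} (hτ : τ ∈ K) (hc : #τ = N)
    (h1 : #(facetsOver K N τ) ≠ 1) : ∃ F F', F ≠ F' ∧ facetsOver K N τ = {F, F'} := by
  refine Finset.card_eq_two.1 ?_
  obtain ⟨F, hF⟩ := H.exists_facet hτ
  have := Finset.card_pos.2 ⟨F, hF⟩
  have := h2 τ hτ hc
  omega

/-- In characteristic two, the sum of all facets is a fundamental class. -/
lemma IsFiniteCM.isOrientation_two (H : IsFiniteCM G K N)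
    (h2 : ∀ τ ∈ K, #τ = N → #(facetsOver K N τ) ≤ 2) :
    IsOrientation K N (fun F => if F ∈ K ∧ #F = N + 1 then (1 : ZMod 2) else 0) where
  eq_zero F hF := if_neg hF
  eq_one_or F hF hc := Or.inl (if_pos ⟨hF, hc⟩)
  cycle τ hτ hc h1 := by
    obtain ⟨F, F', hne, hpair⟩ := H.exists_pair h2 hτ hc h1
    have hF : F ∈ facetsOver K N τ := by simp [hpair]
    have hF' : F' ∈ facetsOver K N τ := by simp [hpair]
    rw [mem_facetsOver] at hF hF'
    rw [hpair, Finset.sum_pair hne, if_pos ⟨hF.1, hF.2.2⟩, if_pos ⟨hF'.1, hF'.2.2⟩, incMat, incMat]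
    rcases inc_eq_one_or hF.2.1 (by omega) with h | h <;>
      rcases inc_eq_one_or hF'.2.1 (by omega) with h' | h' <;> rw [h, h'] <;> decide

/-- A relative top cycle `z` that is not killed by `2` takes the values `± g` only, and its signs
form an orientation. -/
lemma IsFiniteCM.exists_orientation (H : IsFiniteCM G K N)
    (h2 : ∀ τ ∈ K, #τ = N → #(facetsOver K N τ) ≤ 2) (z : Finset V → G)
    (hz : ∀ τ ∈ K, #τ = N → #(facetsOver K N τ) ≠ 1 →
      ∑ F ∈ facetsOver K N τ, inc F τ • z F = 0)
    {F₁ : Finset V} (hF₁ : F₁ ∈ K) (hF₁c : #F₁ = N + 1) (h2z : z F₁ + z F₁ ≠ 0) :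
    ∃ e : Finset V → ℤ, IsOrientation K N e := by
  classical
  set g := z F₁
  have hval : ∀ F ∈ K, #F = N + 1 → z F = g ∨ z F = -g := by
    intro F hF hFc
    have hE : ∅ ∈ K := H.lower F hF ∅ (Finset.empty_subset _)
    refine H.facet_induction hE (fun F => z F = g ∨ z F = -g) ?_
      (mem_facetsOver.2 ⟨hF₁, Finset.empty_subset _, hF₁c⟩)
      (mem_facetsOver.2 ⟨hF, Finset.empty_subset _, hFc⟩) (Or.inl rfl)
    intro τ hτ _ hc F hF F' hF' hp
    by_cases hne : F = F'
    · exact hne ▸ hp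
    have hpair := facetsOver_eq_pair (h2 τ hτ hc) hF hF' hne
    have := hz τ hτ hc (by rw [hpair, Finset.card_pair hne]; decide)
    rw [hpair, Finset.sum_pair hne] at this
    have hFc := (mem_facetsOver.1 hF).2
    have hFc' := (mem_facetsOver.1 hF').2
    have hF'eq : z F' = -((inc F' τ * inc F τ) • z F) := by
      rw [← one_smul ℤ (z F'), ← inc_mul_self hFc'.1 (by omega), mul_smul, mul_smul,
        eq_neg_of_add_eq_zero_right this, smul_neg]
    rcases inc_eq_one_or hFc.1 (by omega) with h | h <;>
      rcases inc_eq_one_or hFc'.1 (by omega) with h' | h' <;>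
      rcases hp with hp | hp <;> simp [hF'eq, hp, h, h']
  set e : Finset V → ℤ := fun F => if F ∈ K ∧ #F = N + 1 then (if z F = g then 1 else -1) else 0
  have he : ∀ F ∈ K, #F = N + 1 → z F = e F • g := by
    intro F hF hFc
    simp only [e, if_pos (And.intro hF hFc)]
    split_ifs with h
    · rw [h, one_smul]
    · rw [neg_one_smul]; exact (hval F hF hFc).resolve_left h
  have he1 : ∀ F ∈ K, #F = N + 1 → e F = 1 ∨ e F = -1 := by
    intro F hF hFc
    simp only [e, if_pos (And.intro hF hFc)]
    split_ifs <;> simp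
  refine ⟨e, fun F hF => if_neg hF, he1, fun τ hτ hc h1 => ?_⟩
  obtain ⟨F, F', hne, hpair⟩ := H.exists_pair h2 hτ hc h1
  have hF : F ∈ facetsOver K N τ := by simp [hpair]
  have hF' : F' ∈ facetsOver K N τ := by simp [hpair]
  rw [mem_facetsOver] at hF hF'
  have := hz τ hτ hc h1
  rw [hpair, Finset.sum_pair hne, he F hF.1 hF.2.2, he F' hF'.1 hF'.2.2, smul_smul, smul_smul,
    ← add_smul] at this
  rw [hpair, Finset.sum_pair hne]
  simp only [incMat, Int.cast_id]
  have h2g : (2 : ℤ) • g ≠ 0 := by rwa [two_smul]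
  rcases inc_eq_one_or hF.2.1 (by omega) with h | h <;>
    rcases inc_eq_one_or hF'.2.1 (by omega) with h' | h' <;>
    rcases he1 F hF.1 hF.2.2 with h3 | h3 <;> rcases he1 F' hF'.1 hF'.2.2 with h4 | h4 <;>
    rw [h, h', h3, h4] at this ⊢ <;> norm_num at this ⊢ <;> exact h2g this

variable (G) in
/-- The nonempty finite complex `B` of dimension `N - 1` has at all its simplices, including the
empty one, the local homology of a sphere. In the top degree, the field `top` says that the local
cycles are parametrized by their value at one facet. -/
structure IsFiniteSphere (B : Finset (Finset V)) (N : ℕ) : Prop where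
  nonempty : B.Nonempty
  lower : ∀ τ ∈ B, ∀ ρ ⊆ τ, ρ ∈ B
  card_le : ∀ τ ∈ B, #τ ≤ N
  exact : ∀ σ ∈ B, ∀ k : ℤ, k ≠ N → IsExactAt G (star B σ) k
  top : ∀ σ ∈ B, ∃ τ ∈ star B σ, #τ = N ∧
    (∀ x : Finset V → G, (∀ ρ ∈ star B σ, #ρ + 1 = N → ∑ τ ∈ star B σ, inc τ ρ • x τ = 0) →
      x τ = 0 → ∀ ρ ∈ star B σ, #ρ = N → x ρ = 0) ∧
    ∀ g : G, ∃ x : Finset V → G, (∀ ρ ∈ star B σ, #ρ + 1 = N →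
      ∑ τ ∈ star B σ, inc τ ρ • x τ = 0) ∧ x τ = g

theorem IsFiniteCM.isFiniteSphere_ridgeBd {R : Type*} [CommRing R] [IsDomain R]
    [IsPrincipalIdealRing R] [Module R G] (H : IsFiniteCM G K N)
    (h2 : ∀ τ ∈ K, #τ = N → #(facetsOver K N τ) ≤ 2) {e : Finset V → R}
    (he : IsOrientation K N e) (hne : (ridgeBd K N).Nonempty) :
    IsFiniteSphere G (ridgeBd K N) N := by
  have HF := he.isFundamental H
  have hcard : ∀ τ ∈ ridgeBd K N, #τ ≤ N := fun τ hτ => by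
    obtain ⟨-, π, -, h1, h2, -⟩ := mem_ridgeBd.1 hτ
    exact h2 ▸ Finset.card_le_card h1
  set b := bdClass K e with hb
  have hb0 : ∀ τ, #τ ≠ N → b τ = 0 := by
    intro τ hτ
    refine Finset.sum_eq_zero fun ρ _ => ?_
    by_contra hne
    have h1 := card_of_inc_ne_zero (inc_ne_zero_of_incMat (left_ne_zero_of_mul hne))
    have h3 := (HF.supp ρ (right_ne_zero_of_mul hne)).2
    omega
  have hB : ∀ ρ ∈ ridgeBd K N, IsExact G (incMat R) (star K ρ) := fun ρ hρ =>
    IsExactAt.isExact fun k => by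
      by_cases hk : (k : ℤ) = N + 1
      · rw [hk]; exact H.isExactAt_of_mem_ridgeBd h2 hρ
      · exact H.exact ρ (mem_ridgeBd.1 hρ).1 k hk
  have hmain : ∀ σ ∈ ridgeBd K N,
      IsExact G (augInc b) (Finset.insertNone (star (ridgeBd K N) σ)) := fun σ hσ =>
    HF.isExact_boundary hB (fun ρ hρ hρB => H.isExact_augInc h2 he hρ hρB) hσ
  -- exactness unfolded: a homogeneous cycle is a boundary up to a multiple of `b`
  have key : ∀ σ ∈ ridgeBd K N, ∀ k : ℤ, ∀ x : Finset V → G,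
      (∀ ρ ∈ star (ridgeBd K N) σ, (#ρ : ℤ) + 1 = k →
        ∑ τ ∈ star (ridgeBd K N) σ, inc τ ρ • x τ = 0) →
      ∃ (g : G) (y : Finset V → G), ∀ ρ ∈ star (ridgeBd K N) σ, (#ρ : ℤ) = k →
        x ρ = b ρ • g + ∑ τ ∈ star (ridgeBd K N) σ, inc τ ρ • y τ := by
    intro σ hσ k x hx
    have hd : ∀ (x : Option (Finset V) → G) ρ,
        dif (augInc b) (Finset.insertNone (star (ridgeBd K N) σ)) x (some ρ) =
          b ρ • x none + ∑ τ ∈ star (ridgeBd K N) σ, inc τ ρ • x (some τ) := fun x ρ => by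
      rw [dif, Finset.sum_insertNone]
      congr 1
      exact Finset.sum_congr rfl fun τ _ => Int.cast_smul_eq_zsmul R _ _
    obtain ⟨y, hy⟩ := hmain σ hσ (fun t => t.elim 0 fun τ => if (#τ : ℤ) = k then x τ else 0) (by
      rintro (_ | ρ) hρ
      · simp [dif, augInc]
      rw [Finset.some_mem_insertNone] at hρ
      rw [hd]
      simp only [Option.elim, smul_zero, zero_add]
      by_cases hc : (#ρ : ℤ) + 1 = k
      · rw [← hx ρ hρ hc]
        refine Finset.sum_congr rfl fun τ _ => ?_
        by_cases h : inc τ ρ = 0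
        · rw [h, zero_smul, zero_smul]
        · rw [if_pos (by rw [card_of_inc_ne_zero h]; exact_mod_cast hc)]
      · refine Finset.sum_eq_zero fun τ _ => ?_
        by_cases h : inc τ ρ = 0
        · rw [h, zero_smul]
        · rw [if_neg (by rw [card_of_inc_ne_zero h]; exact_mod_cast hc), smul_zero])
    refine ⟨y none, fun τ => y (some τ), fun ρ hρ hc => ?_⟩
    have := hy (some ρ) (Finset.some_mem_insertNone.2 hρ)
    rw [hd] at this
    simpa only [Option.elim, if_pos hc] using this
  refine ⟨hne, HF.bd_lower, hcard, ?_, ?_⟩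
  · intro σ hσ k hk x hx
    obtain ⟨g, y, hy⟩ := key σ hσ k x hx
    refine ⟨y, fun ρ hρ hc => ?_⟩
    rw [hy ρ hρ hc, hb0 ρ (by rintro rfl; exact hk hc.symm), zero_smul, zero_add]
  · intro σ hσ
    obtain ⟨hσK, τ, hτK, hστ, hτc, hτ1⟩ := mem_ridgeBd.1 hσ
    have hτB : τ ∈ ridgeBd K N := mem_ridgeBd.2 ⟨hτK, τ, hτK, subset_rfl, hτc, hτ1⟩
    have hbτ : b τ * b τ = 1 := by
      obtain ⟨F, hF⟩ := Finset.card_eq_one.1 hτ1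
      have hF' : F ∈ facetsOver K N τ := by simp [hF]
      obtain ⟨h3, h4, h5⟩ := mem_facetsOver.1 hF'
      have : b τ = incMat R τ F * e F := by
        rw [hb, bdClass, ← star_empty (K := K),
          sum_star_eq (Finset.empty_subset τ) hτc _ fun ρ h => by simp [incMat, h], hF,
          Finset.sum_singleton]
      rw [this]
      have h6 := inc_eq_one_or h4 (by omega)
      rcases h6 with h | h <;> rcases he.eq_one_or F h3 h5 with h' | h' <;>
        simp [incMat, h, h']
    refine ⟨τ, mem_star.2 ⟨hτB, hστ⟩, hτc, ?_, ?_⟩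
    · intro x hx hxτ ρ hρ hρc
      obtain ⟨g, y, hy⟩ := key σ hσ N x fun ρ hρ hc => hx ρ hρ (by exact_mod_cast hc)
      have hy' : ∀ ρ ∈ star (ridgeBd K N) σ, #ρ = N → x ρ = b ρ • g := by
        intro ρ hρ hc
        rw [hy ρ hρ (by rw [hc]), add_eq_left]
        refine Finset.sum_eq_zero fun μ hμ => ?_
        by_cases h : inc μ ρ = 0
        · rw [h, zero_smul]
        · have h3 := hcard μ (mem_star.1 hμ).1
          have h4 := card_of_inc_ne_zero h
          omega
      have hg : g = 0 := by
        rw [← one_smul R g, ← hbτ, mul_smul, ← hy' τ (mem_star.2 ⟨hτB, hστ⟩) hτc, hxτ, smul_zero]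
      rw [hy' ρ hρ hρc, hg, smul_zero]
    · intro g
      refine ⟨fun ρ => b ρ • b τ • g, fun ρ hρ _ => ?_, ?_⟩
      · have hsum : ∑ μ ∈ star (ridgeBd K N) σ, incMat R ρ μ * b μ = 0 := by
          have h3 := HF.sqZero_coneMat (σ := σ) (some (some ρ)) (by
            rw [Finset.some_mem_insertNone, Finset.some_mem_insertNone]
            exact mem_star.2 ⟨HF.bd_subset (mem_star.1 hρ).1, (mem_star.1 hρ).2⟩) none (by simp)
          rw [Finset.sum_insertNone, Finset.sum_insertNone] at h3
          simp only [coneMat, augInc, mul_zero, zero_add] at h3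
          rw [← h3]
          refine Finset.sum_subset (fun μ hμ => mem_star.2
            ⟨HF.bd_subset (mem_star.1 hμ).1, (mem_star.1 hμ).2⟩) fun μ hμ hn => ?_
          rw [hb, bdClass, HF.cycle μ (mem_star.1 hμ).1
            fun h => hn (mem_star.2 ⟨h, (mem_star.1 hμ).2⟩), mul_zero]
        rw [← zero_smul R (b τ • g), ← hsum, Finset.sum_smul]
        exact Finset.sum_congr rfl fun μ _ => by
          rw [mul_smul, incMat, Int.cast_smul_eq_zsmul]
      · dsimp only
        rw [smul_smul, hbτ, one_smul]

end Orientation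

/-! ### Homology spheres -/

section Spheres

variable {V A G : Type*} [LinearOrder V] [CommRing A] [AddCommGroup G] [Module A G] [Nontrivial G]
variable {B : Finset (Finset V)} {N : ℕ}

omit [LinearOrder V] in
lemma isLowerSet_coe (h : ∀ τ ∈ B, ∀ ρ ⊆ τ, ρ ∈ B) : IsLowerSet (B : Set (Finset V)) :=
  fun τ ρ hρ hτ => h τ hτ ρ hρ

lemma isDiff_cost (h : ∀ τ ∈ B, ∀ ρ ⊆ τ, ρ ∈ B) (σ : Finset V) :
    IsDiff (B : Set (Finset V)) (cost (B : Set (Finset V)) σ) (star B σ) where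
  lower := isLowerSet_coe h
  lower' τ ρ hρ hτ := ⟨h τ hτ.1 ρ hρ, fun hσ => hτ.2 (hσ.trans hρ)⟩
  mem_iff ρ := by
    rw [mem_star, cost, Set.mem_ofPred_eq, Finset.mem_coe]
    tauto

omit [Nontrivial G] in
lemma IsFiniteSphere.subsingleton (S : IsFiniteSphere G B N) {σ : Finset V} (hσ : σ ∈ B) {i : ℤ}
    (hi : i ≠ N - 1) : Subsingleton (LocalHomology A G (B : Set (Finset V)) σ i) :=
  (isDiff_cost S.lower σ).subsingleton_iff.2 (S.exact σ hσ _ (by omega))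

omit [Nontrivial G] in
lemma IsFiniteSphere.nonempty_equiv (S : IsFiniteSphere G B N) {σ : Finset V} (hσ : σ ∈ B) :
    Nonempty (LocalHomology A G (B : Set (Finset V)) σ (N - 1) ≃ₗ[A] G) := by
  obtain ⟨τ, hτ, hτc, hinj, hsurj⟩ := S.top σ hσ
  obtain ⟨f⟩ := (isDiff_cost S.lower σ).nonempty_equiv (A := A) (G := G) (i := N - 1) {τ} (by
      intro ρ hρ
      rw [Finset.mem_singleton.1 hρ]
      exact ⟨hτ, by rw [hτc]; ring⟩) (by
      intro ρ hρ
      have := S.card_le ρ (mem_star.1 hρ).1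
      omega) (by
      intro x hx h0 ρ hρ hc
      exact hinj x (fun ρ hρ hc => hx ρ hρ (by omega)) (h0 τ (Finset.mem_singleton_self τ)) ρ hρ
        (by omega)) (by
      intro f
      obtain ⟨x, hx, hxτ⟩ := hsurj (f ⟨τ, Finset.mem_singleton_self τ⟩)
      refine ⟨x, fun ρ hρ hc => hx ρ hρ (by omega), ?_⟩
      rintro ⟨ρ, hρ⟩
      obtain rfl := Finset.mem_singleton.1 hρ
      exact hxτ)
  exact ⟨f.trans (LinearEquiv.funUnique _ A G)⟩

omit [Nontrivial G] in
lemma IsFiniteSphere.empty_mem (S : IsFiniteSphere G B N) : ∅ ∈ B := by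
  obtain ⟨σ, hσ⟩ := S.nonempty
  exact S.lower σ hσ ∅ (Finset.empty_subset _)

omit [Nontrivial G] in
lemma IsFiniteSphere.hasDim (S : IsFiniteSphere G B N) : HasDim (B : Set (Finset V)) (N - 1) := by
  constructor
  · obtain ⟨τ, hτ, hτc, -⟩ := S.top ∅ S.empty_mem
    exact ⟨τ, (mem_star.1 hτ).1, by simp [hτc]⟩
  · rintro _ ⟨τ, hτ, rfl⟩
    have := S.card_le τ hτ
    simp only
    omega

lemma IsFiniteSphere.bd_eq_empty (S : IsFiniteSphere G B N) :
    Bd A G (B : Set (Finset V)) (N - 1) = ∅ := by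
  refine Set.eq_empty_of_forall_notMem fun σ hσ => ?_
  obtain ⟨f⟩ := S.nonempty_equiv (A := A) hσ.1
  have := hσ.2
  exact not_subsingleton G f.symm.toEquiv.subsingleton

lemma IsFiniteSphere.isOrientable (S : IsFiniteSphere G B N) :
    IsOrientable A G (B : Set (Finset V)) (N - 1) := by
  have h : cost (B : Set (Finset V)) ∅ = ∅ := by
    ext τ; simp [cost]
  have := S.nonempty_equiv (A := A) S.empty_mem
  change Nonempty (Homology A G _ (cost _ ∅) _ ≃ₗ[A] G) at this
  rw [h] at this
  rwa [IsOrientable, S.bd_eq_empty]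

/-- If all facets contain `v`, each of them is the only one over its face opposite to `v`, so there
are no top cycles. -/
lemma IsFiniteSphere.not_isConePoint (S : IsFiniteSphere G B N) (v : V) :
    ¬ IsConePoint (B : Set (Finset V)) v := by
  rintro ⟨-, hv⟩
  have hmax : ∀ F ∈ B, #F = N → v ∈ F := fun F hF hc => hv F
    ⟨hF, fun F' hF' hle => (Finset.eq_of_subset_of_card_le hle
      (hc ▸ S.card_le F' hF')).ge⟩
  obtain ⟨τ, hτ, hτc, -, hsurj⟩ := S.top ∅ S.empty_mem
  obtain ⟨g, hg⟩ := exists_ne (0 : G)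
  obtain ⟨x, hx, rfl⟩ := hsurj g
  have hτB := (mem_star.1 hτ).1
  have hvτ := hmax τ hτB hτc
  have hc := Finset.card_erase_add_one hvτ
  have h0 := hx (τ.erase v) (mem_star.2
    ⟨S.lower τ hτB _ (Finset.erase_subset _ _), Finset.empty_subset _⟩) (by omega)
  rw [Finset.sum_eq_single τ] at h0
  · exact hg (inc_smul_eq_zero (Finset.erase_subset _ _) hc.symm h0)
  · intro F hF hne
    by_cases h : inc F (τ.erase v) = 0
    · rw [h, zero_smul]
    · have h1 := card_of_inc_ne_zero h
      have hvF := hmax F (mem_star.1 hF).1 (by omega)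
      refine absurd (Finset.eq_of_subset_of_card_le ?_ (by omega)).symm hne
      rw [← Finset.insert_erase hvτ]
      exact Finset.insert_subset hvF (subset_of_inc_ne_zero h)
  · exact fun h => absurd hτ h

lemma IsFiniteSphere.isGorenstein (S : IsFiniteSphere G B N) :
    IsGorenstein A G (B : Set (Finset V)) := by
  have hcore : core (B : Set (Finset V)) = B := by
    ext σ
    exact ⟨fun h => h.1, fun h => ⟨h, fun v _ => S.not_isConePoint v⟩⟩
  refine ⟨B.finite_toSet, S.nonempty, N - 1, ?_⟩
  rw [hcore]
  exact ⟨S.hasDim, fun σ hσ => ⟨fun i hi => S.subsingleton hσ hi, S.nonempty_equiv hσ⟩⟩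

lemma inc_singleton (v : V) : inc {v} ∅ = 1 := by
  have := inc_erase (Finset.mem_singleton_self v)
  simpa [Finset.filter_singleton] using this

lemma IsFiniteSphere.isConnected (S : IsFiniteSphere G B N) (hN : N ≠ 1) :
    IsConnected (B : Set (Finset V)) := by
  intro u v hu hv
  have hex := S.exact ∅ S.empty_mem 1 (by exact_mod_cast hN.symm)
  rw [star_empty] at hex
  refine IsExactAt.connected (ρ := ∅) (X := B) (a := {u}) (c := {v}) (by simpa using hex)
    (fun ρ' _ h => by simpa using h) (fun μ hμ τ _ h => S.lower μ hμ τ h)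
    (fun τ => ∀ w ∈ τ, Relation.ReflTransGen (fun x y : V => {x, y} ∈ (B : Set (Finset V))) u w)
    ?_ hu hv (by simp [inc_singleton]) (by simp [inc_singleton]) ?_ v (by simp)
  · intro μ hμ τ hτ τ' hτ' hne hne' hp w' hw'
    have hc := card_of_inc_ne_zero (right_ne_zero_of_mul hne)
    obtain ⟨w, hw⟩ : τ.Nonempty := Finset.card_pos.1 (by omega)
    refine (hp w hw).tail (S.lower μ hμ _ ?_)
    exact Finset.insert_subset (subset_of_inc_ne_zero (left_ne_zero_of_mul hne) hw)
      (Finset.singleton_subset_iff.2 (subset_of_inc_ne_zero (left_ne_zero_of_mul hne') hw'))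
  · intro w hw
    rw [Finset.mem_singleton.1 hw]

/-- A `0`-dimensional sphere has two points, even when `G` is isomorphic to some power of itself:
the top cycles are determined by one value. -/
lemma IsFiniteSphere.isTwoPoints (S : IsFiniteSphere G B 1) :
    IsTwoPoints (B : Set (Finset V)) := by
  obtain ⟨τ, hτ, hτc, hinj, hsurj⟩ := S.top ∅ S.empty_mem
  rw [star_empty] at hτ hinj hsurj
  obtain ⟨a, rfl⟩ := Finset.card_eq_one.1 hτc
  obtain ⟨g, hg⟩ := exists_ne (0 : G)
  have hcyc : ∀ x : Finset V → G, (∀ ρ ∈ B, #ρ + 1 = 1 → ∑ τ ∈ B, inc τ ρ • x τ = 0) ↔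
      ∑ τ ∈ B, inc τ ∅ • x τ = 0 := by
    intro x
    refine ⟨fun h => h ∅ S.empty_mem rfl, fun h ρ _ hc => ?_⟩
    obtain rfl : ρ = ∅ := Finset.card_eq_zero.1 (by omega)
    exact h
  obtain ⟨b, hbB, hab⟩ : ∃ b, {b} ∈ B ∧ a ≠ b := by
    obtain ⟨x, hx, rfl⟩ := hsurj g
    rw [hcyc] at hx
    by_contra! hn
    rw [Finset.sum_eq_single {a}] at hx
    · rw [inc_singleton, one_smul] at hx; exact hg hx
    · intro F hF hne
      by_cases h : inc F ∅ = 0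
      · rw [h, zero_smul]
      · obtain ⟨b, rfl⟩ := Finset.card_eq_one.1 (card_of_inc_ne_zero h)
        exact absurd (congrArg _ (hn b hF).symm) hne
    · exact fun h => absurd hτ h
  refine ⟨a, b, hab, ?_⟩
  ext σ
  simp only [Finset.mem_coe, Set.mem_insert_iff, Set.mem_singleton_iff]
  refine ⟨fun hσ => ?_, ?_⟩
  · have hσc := S.card_le σ hσ
    by_contra! hn
    obtain ⟨c, rfl⟩ := Finset.card_eq_one.1
      (le_antisymm hσc (Finset.card_pos.2 hn.1))
    -- a third vertex `c` would carry, with `b`, a cycle that vanishes at `a`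
    have hbc : ({b} : Finset V) ≠ {c} := hn.2.2.symm
    have h0 := hinj (fun τ => if τ = {b} then g else if τ = {c} then -g else 0) (by
      rw [hcyc, ← Finset.sum_subset (s₁ := {{b}, {c}}), Finset.sum_pair hbc]
      · simp [inc_singleton, hbc.symm]
      · intro τ hτ
        rcases Finset.mem_insert.1 hτ with rfl | hτ
        · exact hbB
        · rw [Finset.mem_singleton.1 hτ]; exact hσ
      · intro τ _ hτ
        simp only [Finset.mem_insert, Finset.mem_singleton, not_or] at hτ
        simp [hτ.1, hτ.2]) (by simp [hab, hn.2.1.symm]) {b} hbB (by simp)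
    simp only [if_true] at h0
    exact hg h0
  · rintro (rfl | rfl | rfl)
    · exact S.empty_mem
    · exact hτ
    · exact hbB

lemma IsFiniteSphere.isHomologyManifold (S : IsFiniteSphere G B N) :
    IsHomologyManifold A G (B : Set (Finset V)) (N - 1) := by
  by_cases hN : N = 1
  · subst hN
    exact Or.inl ⟨S.isTwoPoints, by simp⟩
  · exact Or.inr ⟨S.hasDim, S.isConnected hN, fun v => B.finite_toSet.subset fun σ h => h.1,
      fun σ hσ _ i hi => S.subsingleton hσ hi, fun σ hσ _ => Or.inr (S.nonempty_equiv hσ),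
      ∅, S.empty_mem, S.nonempty_equiv S.empty_mem⟩

end Spheres

/-! ### The boundary of the manifold -/

section Manifold

variable {V A G : Type*} [LinearOrder V] [CommRing A] [AddCommGroup G] [Module A G] [Nontrivial G]
variable {K : Finset (Finset V)} {N : ℕ}

omit [Nontrivial G] in
lemma IsFiniteCM.eq_zero_of_isExactAt (H : IsFiniteCM G K N) {σ : Finset V}
    (hex : IsExactAt G (star K σ) (N + 1)) {x : Finset V → G}
    (hx : ∀ ρ ∈ star K σ, #ρ = N → ∑ τ ∈ star K σ, inc τ ρ • x τ = 0) {F : Finset V}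
    (hF : F ∈ facetsOver K N σ) : x F = 0 := by
  obtain ⟨hFK, hσF, hFc⟩ := mem_facetsOver.1 hF
  obtain ⟨y, hy⟩ := hex x fun ρ hρ hc => hx ρ hρ (by exact_mod_cast add_right_cancel hc)
  rw [hy F (mem_star.2 ⟨hFK, hσF⟩) (by exact_mod_cast hFc)]
  refine Finset.sum_eq_zero fun τ hτ => ?_
  by_cases h : inc τ F = 0
  · rw [h, zero_smul]
  · have h1 := card_of_inc_ne_zero h
    have h2 := H.card_le τ (mem_star.1 hτ).1
    omega

omit [Nontrivial G] in
/-- Around a ridge there is only one condition on a top cycle. -/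
lemma cycle_over_ridge {τ : Finset V} (hτ : #τ = N) {x : Finset V → G}
    (hx : ∑ F ∈ facetsOver K N τ, inc F τ • x F = 0) :
    ∀ ρ ∈ star K τ, #ρ = N → ∑ μ ∈ star K τ, inc μ ρ • x μ = 0 := by
  intro ρ hρ hc
  obtain rfl := Finset.eq_of_subset_of_card_le (mem_star.1 hρ).2 (hc.trans hτ.symm).le
  rwa [sum_smul_star_eq subset_rfl hτ]

lemma IsFiniteCM.card_facetsOver_eq_one (H : IsFiniteCM G K N) {τ : Finset V} (hτ : τ ∈ K)
    (hc : #τ = N) (hex : IsExactAt G (star K τ) (N + 1)) : #(facetsOver K N τ) = 1 := by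
  classical
  obtain ⟨F, hF⟩ := H.exists_facet hτ
  by_contra hne
  obtain ⟨F', hF', hFF'⟩ := Finset.exists_mem_ne
    (lt_of_le_of_ne (Finset.card_pos.2 ⟨F, hF⟩) (Ne.symm hne)) F
  obtain ⟨g, hg⟩ := exists_ne (0 : G)
  have sq : ∀ {F}, F ∈ facetsOver K N τ → inc F τ * inc F τ = 1 := fun {F} hF => by
    have := (mem_facetsOver.1 hF).2
    exact inc_mul_self this.1 (by omega)
  have h0 := H.eq_zero_of_isExactAt hex (x := fun μ => if μ = F then inc F τ • g else
    if μ = F' then - (inc F' τ • g) else 0) (cycle_over_ridge hc (by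
      rw [← Finset.sum_subset (s₁ := {F, F'}), Finset.sum_pair hFF'.symm]
      · simp [hFF', smul_smul, sq hF, sq hF']
      · intro μ hμ
        rcases Finset.mem_insert.1 hμ with rfl | hμ
        · exact hF
        · rw [Finset.mem_singleton.1 hμ]; exact hF'
      · intro μ _ hμ
        simp only [Finset.mem_insert, Finset.mem_singleton, not_or] at hμ
        simp [hμ.1, hμ.2])) hF
  simp only [if_true] at h0
  refine hg ?_
  rw [← one_smul ℤ g, ← sq hF, mul_smul, h0, smul_zero]

lemma IsFiniteCM.mem_ridgeBd_of_isExactAt {R : Type*} [CommRing R] [Module R G]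
    (H : IsFiniteCM G K N) {e : Finset V → R} (he : IsOrientation K N e) {σ : Finset V}
    (hσ : σ ∈ K) (hex : IsExactAt G (star K σ) (N + 1)) : σ ∈ ridgeBd K N := by
  by_contra hσB
  obtain ⟨g, hg⟩ := exists_ne (0 : G)
  obtain ⟨F, hF⟩ := H.exists_facet hσ
  have h0 := H.eq_zero_of_isExactAt hex (x := fun F => e F • g) (by
    intro ρ hρ hc
    obtain ⟨hρK, hσρ⟩ := mem_star.1 hρ
    have h1 := he.cycle ρ hρK hc fun h => hσB (mem_ridgeBd.2 ⟨hσ, ρ, hρK, hσρ, hc, h⟩)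
    rw [sum_smul_star_eq hσρ hc, ← zero_smul R g, ← h1, Finset.sum_smul]
    exact Finset.sum_congr rfl fun F _ => by
      rw [mul_smul, incMat, Int.cast_smul_eq_zsmul]) hF
  obtain ⟨hFK, -, hFc⟩ := mem_facetsOver.1 hF
  rcases he.eq_one_or F hFK hFc with h | h <;> rw [h] at h0 <;> simp at h0 <;> exact hg h0

omit [Nontrivial G] in
/-- The top local homology at a ridge is `G ^ (d - 1)`, where `d` is the number of facets over it.
-/
lemma IsFiniteCM.nonempty_equiv_ridge (H : IsFiniteCM G K N) {τ : Finset V}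
    (hc : #τ = N) {F₀ : Finset V} (hF₀ : F₀ ∈ facetsOver K N τ) :
    Nonempty (LocalHomology A G (K : Set (Finset V)) τ N ≃ₗ[A]
      ((facetsOver K N τ).erase F₀ → G)) := by
  have hinc := mem_facetsOver.1 hF₀
  have sq : inc F₀ τ * inc F₀ τ = 1 := inc_mul_self hinc.2.1 (by omega)
  refine (isDiff_cost H.lower τ).nonempty_equiv _ ?_ ?_ ?_ ?_
  · intro ρ hρ
    obtain ⟨h1, h2, h3⟩ := mem_facetsOver.1 (Finset.mem_of_mem_erase hρ)
    exact ⟨mem_star.2 ⟨h1, h2⟩, by exact_mod_cast h3⟩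
  · intro ρ hρ
    have := H.card_le ρ (mem_star.1 hρ).1
    omega
  · intro x hx h0 ρ hρ hρc
    have hρF : ρ ∈ facetsOver K N τ := mem_facetsOver.2
      ⟨(mem_star.1 hρ).1, (mem_star.1 hρ).2, by exact_mod_cast hρc⟩
    by_cases hne : ρ = F₀
    · subst hne
      have h1 := hx τ (mem_star.2 ⟨H.lower ρ hinc.1 τ hinc.2.1, subset_rfl⟩) (by rw [hc])
      rw [sum_smul_star_eq subset_rfl hc, ← Finset.add_sum_erase _ _ hρF, Finset.sum_eq_zero,
        add_zero] at h1
      · exact inc_smul_eq_zero hinc.2.1 (by omega) h1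
      · intro F hF
        rw [h0 F hF, smul_zero]
    · exact h0 ρ (Finset.mem_erase.2 ⟨hne, hρF⟩)
  · intro f
    set x : Finset V → G := fun F => if h : F ∈ (facetsOver K N τ).erase F₀ then f ⟨F, h⟩ else 0
    refine ⟨fun F => if F = F₀ then
      - (inc F₀ τ • ∑ F ∈ (facetsOver K N τ).erase F₀, inc F τ • x F) else x F, ?_, ?_⟩
    · intro ρ hρ hρc
      refine cycle_over_ridge hc ?_ ρ hρ (by exact_mod_cast hρc)
      rw [← Finset.add_sum_erase _ _ hF₀, if_pos rfl, smul_neg, smul_smul, sq, one_smul,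
        neg_add_eq_zero]
      exact Finset.sum_congr rfl fun F hF => by rw [if_neg (Finset.ne_of_mem_erase hF)]
    · rintro ⟨F, hF⟩
      simp only [if_neg (Finset.ne_of_mem_erase hF), x, dif_pos hF]

omit [Nontrivial G] in
lemma isFiniteCM_of_isCohenMacaulay (hK : IsLowerSet (K : Set (Finset V)))
    (hcm : IsCohenMacaulay A G (K : Set (Finset V)) N) : IsFiniteCM G K N where
  lower τ hτ ρ hρ := hK hρ hτ
  card_le τ hτ := by
    have := hcm.1.2 ⟨τ, hτ, rfl⟩
    simp only at this
    omega
  exact σ hσ k hk := by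
    have := (isDiff_cost (fun τ hτ ρ hρ => hK hρ hτ) σ).subsingleton_iff.1
      (hcm.2 σ hσ (k - 1) (by omega))
    rwa [sub_add_cancel] at this

lemma card_facetsOver_le_two
    (hman : IsHomologyManifold A G (K : Set (Finset V)) N)
    (hpow : ∀ m : ℕ, 2 ≤ m → Nonempty (G ≃ₗ[A] (Fin m → G)) →
      ∀ τ ∈ K, #τ = N → #(facetsOver K N τ) ≤ 2)
    (H : IsFiniteCM G K N) {τ : Finset V} (hτ : τ ∈ K) (hc : #τ = N) :
    #(facetsOver K N τ) ≤ 2 := by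
  by_cases hτe : τ = ∅
  · subst hτe
    obtain rfl : N = 0 := by simpa using hc.symm
    rcases hman with ⟨⟨a, b, hab, hKab⟩, -⟩ | ⟨-, hconn, -⟩
    · refine (Finset.card_le_card (t := {{a}, {b}}) fun F hF => ?_).trans Finset.card_le_two
      obtain ⟨hF, -, hFc⟩ := mem_facetsOver.1 hF
      have : F ∈ (K : Set (Finset V)) := hF
      rw [hKab] at this
      rcases this with rfl | h
      · simp at hFc
      · simpa using h
    · refine (Finset.card_le_one.2 fun F hF F' hF' => ?_).trans one_le_two
      obtain ⟨hF, -, hFc⟩ := mem_facetsOver.1 hF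
      obtain ⟨hF', -, hFc'⟩ := mem_facetsOver.1 hF'
      obtain ⟨u, rfl⟩ := Finset.card_eq_one.1 hFc
      obtain ⟨v, rfl⟩ := Finset.card_eq_one.1 hFc'
      have key : ∀ w, Relation.ReflTransGen (fun x y : V => {x, y} ∈ (K : Set (Finset V))) u w →
          u = w := by
        intro w hw
        induction hw with
        | refl => rfl
        | tail _ hxy ih =>
          subst ih
          by_contra hne
          have := H.card_le _ hxy
          rw [Finset.card_pair hne] at this
          omega
      rw [key v (hconn u v hF hF')]
  -- with `d` facets over `τ` the top local homology `G ^ (d - 1)` is `0` or `G`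
  · by_contra! h3
    obtain ⟨F₀, hF₀⟩ := Finset.card_pos.1 (by omega : 0 < #(facetsOver K N τ))
    obtain ⟨f⟩ := H.nonempty_equiv_ridge (A := A) hc hF₀
    have hcard := Finset.card_erase_of_mem hF₀
    rcases hman with ⟨-, hN⟩ | ⟨-, -, -, -, h01, -⟩
    · exact hτe (Finset.card_eq_zero.1 (by omega))
    rcases h01 τ hτ hτe with hs | hs
    · have hne : ((facetsOver K N τ).erase F₀).Nonempty := Finset.card_pos.1 (by omega)
      have : Nonempty ((facetsOver K N τ).erase F₀) := hne.to_subtype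
      exact not_subsingleton _ f.symm.toEquiv.subsingleton
    · obtain ⟨f'⟩ := hs
      have e := ((facetsOver K N τ).erase F₀).equivFin
      have := hpow _ (by omega) ⟨(f'.symm.trans f).trans (LinearEquiv.funCongrLeft A G e.symm)⟩
        τ hτ hc
      omega

/-- An orientable complex has a relative top cycle that is not killed by `2`, unless `2` kills `G`.
-/
lemma exists_cycle_of_isOrientable (H : IsFiniteCM G K N)
    (hor : IsOrientable A G (K : Set (Finset V)) N) {g : G} (hg : g + g ≠ 0) :
    ∃ z : Finset V → G, (∀ τ ∈ K, #τ = N → #(facetsOver K N τ) ≠ 1 →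
      ∑ F ∈ facetsOver K N τ, inc F τ • z F = 0) ∧
      ∃ F ∈ K, #F = N + 1 ∧ z F + z F ≠ 0 := by
  obtain ⟨f⟩ := hor
  obtain ⟨c, hc⟩ := Submodule.Quotient.mk_surjective _ (f.symm g)
  have hcne : (c : Finset V →₀ G) + c ≠ 0 := by
    intro h
    apply hg
    rw [← f.apply_symm_apply g, ← map_add, ← hc, ← Submodule.Quotient.mk_add,
      show c + c = 0 from Subtype.ext h, Submodule.Quotient.mk_zero, map_zero]
  obtain ⟨h1, h2⟩ := Submodule.mem_inf.1 c.2
  rw [Submodule.mem_comap, mem_chains] at h2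
  rw [mem_chains] at h1
  refine ⟨c, fun τ hτ hτc hne => ?_, ?_⟩
  · have h3 := sum_smul_star_eq (K := K) (Finset.empty_subset τ) hτc (c : Finset V →₀ G)
    rw [star_empty] at h3
    rw [← h3, ← bdry_apply (A := A) _ (fun F hF => (h1 F (Finsupp.mem_support_iff.1 hF)).1)]
    by_contra h0
    refine hne (H.card_facetsOver_eq_one hτ hτc ?_)
    have := (h2 τ h0).1.2
    exact (isDiff_cost H.lower τ).subsingleton_iff.1 this
  · obtain ⟨F, hF⟩ := Finsupp.ne_iff.1 hcne
    have hF0 : (c : Finset V →₀ G) F ≠ 0 := by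
      intro h; apply hF; simp [h]
    obtain ⟨h3, h4⟩ := h1 F hF0
    exact ⟨F, h3, by exact_mod_cast h4, hF⟩

lemma IsFiniteCM.bd_eq {R : Type*} [CommRing R] [Module R G] (H : IsFiniteCM G K N)
    (h2 : ∀ τ ∈ K, #τ = N → #(facetsOver K N τ) ≤ 2)
    {e : Finset V → R} (he : IsOrientation K N e) :
    Bd A G (K : Set (Finset V)) N = ridgeBd K N := by
  ext σ
  constructor
  · rintro ⟨hσ, hs⟩
    exact H.mem_ridgeBd_of_isExactAt he hσ ((isDiff_cost H.lower σ).subsingleton_iff.1 hs)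
  · intro hσ
    exact ⟨(mem_ridgeBd.1 hσ).1, (isDiff_cost H.lower σ).subsingleton_iff.2
      (H.isExactAt_of_mem_ridgeBd h2 hσ)⟩

lemma exists_isFiniteSphere (H : IsFiniteCM G K N)
    (h2 : ∀ τ ∈ K, #τ = N → #(facetsOver K N τ) ≤ 2)
    (hor : IsOrientable A G (K : Set (Finset V)) N)
    (hbd : (Bd A G (K : Set (Finset V)) N).Nonempty) :
    ∃ B : Finset (Finset V), Bd A G (K : Set (Finset V)) N = B ∧ IsFiniteSphere G B N := by
  by_cases h2G : ∀ g : G, 2 • g = 0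
  -- if `2` kills `G`, then `K` need not be orientable by signs, but one may compute over `ZMod 2`
  · let _ : Module (ZMod 2) G := AddCommGroup.zmodModule h2G
    have he := H.isOrientation_two h2
    have hB := H.bd_eq (A := A) h2 he
    have : Fact (Nat.Prime 2) := ⟨Nat.prime_two⟩
    rw [hB] at hbd ⊢
    exact ⟨_, rfl, H.isFiniteSphere_ridgeBd h2 he hbd⟩
  · push Not at h2G
    obtain ⟨g, hg⟩ := h2G
    rw [two_smul] at hg
    obtain ⟨z, hz, F, hF, hFc, hF2⟩ := exists_cycle_of_isOrientable H hor hg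
    obtain ⟨e, he⟩ := H.exists_orientation h2 z hz hF hFc hF2
    have hB := H.bd_eq (A := A) h2 he
    rw [hB] at hbd ⊢
    exact ⟨_, rfl, H.isFiniteSphere_ridgeBd h2 he hbd⟩

/-- The complex `{∅}` of dimension `-1` has empty boundary. -/
lemma nonneg_of_bd_nonempty (hK : IsLowerSet (K : Set (Finset V))) {n : ℤ}
    (hdim : HasDim (K : Set (Finset V)) n)
    (hbd : (Bd A G (K : Set (Finset V)) n).Nonempty) : 0 ≤ n := by
  by_contra! hn
  have hcard : ∀ τ ∈ K, τ = ∅ := fun τ hτ => by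
    have := hdim.2 ⟨τ, hτ, rfl⟩
    simp only at this
    exact Finset.card_eq_zero.1 (by omega)
  obtain ⟨σ, hσ, hs⟩ := hbd
  obtain rfl := hcard σ hσ
  have hn1 : n = -1 := by
    have := hdim.2 ⟨∅, hσ, rfl⟩
    simp at this
    omega
  subst hn1
  have hK1 : star K ∅ = {∅} := by
    rw [star_empty]
    exact Finset.eq_singleton_iff_unique_mem.2 ⟨hσ, hcard⟩
  obtain ⟨g, hg⟩ := exists_ne (0 : G)
  have hex := (isDiff_cost (fun τ hτ ρ hρ => hK hρ hτ) ∅).subsingleton_iff.1 hs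
  rw [hK1] at hex
  obtain ⟨y, hy⟩ := hex (fun _ => g) (by simp)
  have := hy ∅ (by simp) (by simp)
  rw [Finset.sum_singleton, inc_self, zero_smul] at this
  exact hg this

end Manifold

end Augmental

end

theorem theorem13 {A G V : Type*} [CommRing A] [AddCommGroup G] [Module A G] [Nontrivial G]
    [LinearOrder V] (K : Set (Finset V)) (n : ℤ) (hK : IsLowerSet K) (hfin : K.Finite)
    (hman : Augmental.IsHomologyManifold A G K n)
    (hpow : ∀ m : ℕ, 2 ≤ m → Nonempty (G ≃ₗ[A] (Fin m → G)) →
      ∀ τ ∈ K, (#τ : ℤ) = n → {σ | σ ∈ K ∧ τ ⊆ σ ∧ (#σ : ℤ) = n + 1}.ncard ≤ 2)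
    (hcm : Augmental.IsCohenMacaulay A G K n)
    (hor : Augmental.IsOrientable A G K n)
    (hbd : (Augmental.Bd A G K n).Nonempty) :
    IsLowerSet (Augmental.Bd A G K n) ∧
    Augmental.IsHomologyManifold A G (Augmental.Bd A G K n) (n - 1) ∧
    Augmental.Bd A G (Augmental.Bd A G K n) (n - 1) = ∅ ∧
    Augmental.IsOrientable A G (Augmental.Bd A G K n) (n - 1) ∧
    Augmental.IsGorenstein A G (Augmental.Bd A G K n) := by
  obtain ⟨K, rfl⟩ := hfin.exists_finset_coe
  lift n to ℕ using Augmental.nonneg_of_bd_nonempty hK hcm.1 hbd with N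
  have H := Augmental.isFiniteCM_of_isCohenMacaulay hK hcm
  have h2 : ∀ τ ∈ K, #τ = N → #(Augmental.facetsOver K N τ) ≤ 2 := fun τ hτ hc =>
    Augmental.card_facetsOver_le_two hman (fun m hm e τ hτ hc => by
      rw [← Set.ncard_coe_finset]
      convert hpow m hm e τ hτ (by exact_mod_cast hc) using 2
      ext F
      rw [Finset.mem_coe, Augmental.mem_facetsOver]
      simp only [Set.mem_ofPred_eq, Finset.mem_coe]
      norm_cast) H hτ hc
  obtain ⟨B, hB, S⟩ := Augmental.exists_isFiniteSphere H h2 hor hbd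
  rw [hB]
  exact ⟨Augmental.isLowerSet_coe S.lower, S.isHomologyManifold, S.bd_eq_empty, S.isOrientable,
    S.isGorenstein⟩
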